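/- Let $a<b$. A real function $f$ on $[a,b]$ is *regulated* if the finite limits $f(t-)$, $t\in(a,b]$, and $f(s+)$, $s\in[a,b)$, exist; put $\Delta^-f(t)=f(t)-f(t-)$, $\Delta^-f(a)=0$, $\Delta^+f(s)=f(s+)-f(s)$, $\Delta^+f(b)=0$. Write $f\gg0$ if there is $C>0$ with $f(t)\ge C$ for all $t\in[a,b]$. Let $\Lambda[a,b]$ be the set of nested sequences $\lambda=(\lambda_m)_{m\ge1}$ of partitions $\lambda_m=\{a=t_0^m<\dots<t_{n(m)}^m=b\}$ of $[a,b]$ ($\lambda_m\subset\lambda_{m+1}$) whose union $\cup\lambda:=\bigcup_m\lambda_m$ is dense in $[a,b]$. Fix $\lambda\in\Lambda[a,b]$. For $a\le s<t\le b$ put $x_i^m=(t_i^m\wedge t)\vee s$, $0\le i\le n(m)$. * A regulated function $f$ has the *quadratic $\lambda$-variation* ($f\in Q_\lambda[a,b]$) if there is a regulated $V$ with $V(a)=0$ such that for all $a\le s<t\le b$: $V(t)-V(s)=\lim_{m}\sum_{i=1}^{n(m)}[f(x_i^m)-f(x_{i-1}^m)]^2$, $\Delta^-V(t)=(\Delta^-f(t))^2$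 and $\Delta^+V(s)=(\Delta^+f(s))^2$. * $L_\lambda[a,b]$ is the set of $f\in Q_\lambda[a,b]$ with $f(a)=1$, $f\gg0$ and $\{t\in(a,b):\Delta^+f(t)\ne0\}\subset\cup\lambda$. $E_\lambda[a,b]$ is the set of $g\in Q_\lambda[a,b]$ with $g(a)=0$, $1+\min(\Delta^-g,\Delta^+g)\gg0$ and $\{t\in(a,b):\Delta^+g(t)\ne0\}\subset\cup\lambda$. * For regulated $g,f$, the *Left Cauchy $\lambda$-integral* $(LC)\int g\,d_\lambda f$ is defined on $[a,b]$ if there is a regulated $\Phi$ with $\Phi(a)=0$ such that for all $a\le s<t\le b$: $\Phi(t)-\Phi(s)=\lim_m\sum_{i=1}^{n(m)}g(x_{i-1}^m)[f(x_i^m)-f(x_{i-1}^m)]$, $\Delta^-\Phi(t)=g(t-)\Delta^-f(t)$ and $\Delta^+\Phi(s)=g(s)\Delta^+f(s)$. Then $(LC)\int_s^tg\,d_\lambda f:=\Phi(t)-\Phi(s)$. The function $\mathcal L_\lambda f$ is defined if $(LC)\int f^{-1}d_\lambda f$ is, and then $\mathcal L_\lambda f(t):=(LC)\int_a^tf^{-1}d_\lambda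 f$, $t\in[a,b]$. * For a regulated $f$, the *product $\lambda$-integral* of $1+d_\lambda f$ is defined on $[a,b]$ if there is a regulated $H$ with $H(a)=1$ and $|H|\gg0$ such that for all $a\le s<t\le b$: $H(t)/H(s)=\lim_m\prod_{i=1}^{n(m)}[1+f(x_i^m)-f(x_{i-1}^m)]$, $H(t)/H(t-)=1+\Delta^-f(t)$ and $H(s+)/H(s)=1+\Delta^+f(s)$. Its value over $[s,t]$, $a\le s\le t\le b$, is $\mathcal{P}_s^t(1+d_\lambda f):=H(t)/H(s)$. * An *evolution* on $[a,b]$ is a family of reals $U(t,s)$, $a\le s\le t\le b$, with $U(r,t)U(t,s)=U(r,s)$ for $a\le s\le t\le r\le b$ and $U(t,t)=1$. It is *regulated* if $U_a:=U(\cdot,a)$ is regulated and $|U_a|\gg0$. A function $G$ is the *$\lambda$-generator* of a regulated evolution $U$ if $G$ is regulated, $G(a)=0$ and for all $a\le s<t\le b$: $G(t)-G(s)=\lim_m\sum_{i=1}^{n(m)}[U(x_i^m,x_{i-1}^m)-1]$, $\Delta^-G(t)=U_a(t)/U_a(t-)-1$ and $\Delta^+G(s)=U_a(s+)/U_a(s)-1$.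 **Theorem.** Let $\lambda\in\Lambda[a,b]$ and let $U$ be a regulated evolution in $\mathbb R$ on $[a,b]$ with $U_a\in L_\lambda[a,b]$. Then: (a) $\mathcal L_\lambda U_a$ is defined on $[a,b]$, belongs to $E_\lambda[a,b]$, and is the $\lambda$-generator of $U$; (b) the product $\lambda$-integral of $1+d_\lambda(\mathcal L_\lambda U_a)$ is defined on $[a,b]$; (c) $U(t,s)=\mathcal{P}_s^t\big(1+d_\lambda(\mathcal L_\lambda U_a)\big)$ for all $a\le s\le t\le b$, and $\mathcal L_\lambda U_a$ is the only such function up to an additive constant: if $g$ is a function on $[a,b]$ with $g-g(a)\in E_\lambda[a,b]$, then the product $\lambda$-integral of $1+d_\lambda g$ is defined on $[a,b]$ with $U(t,s)=\mathcal{P}_s^t(1+d_\lambda g)$ for all $a\le s\le t\le b$ if and only if $g=\mathcal L_\lambda U_a+c$ on $[a,b]$ for some constant $c$. -/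

import Mathlib

open Filter Topology Set

/-- A nested sequence `λ = (λ_m)` of partitions `λ_m = {t_0^m < ... < t_{n(m)}^m}` of `[a, b]`
whose union is dense in `[a, b]`. Only the points `pt m i` with `i ≤ n m` matter. -/
structure PartitionSeq (a b : ℝ) where
  n : ℕ → ℕ
  pt : ℕ → ℕ → ℝ
  pt_first : ∀ m, pt m 0 = a
  pt_last : ∀ m, pt m (n m) = b
  pt_strictMono : ∀ m, StrictMonoOn (pt m) (Set.Iic (n m))
  nested : ∀ m, pt m '' Set.Iic (n m) ⊆ pt (m + 1) '' Set.Iic (n (m + 1))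
  dense : Set.Icc a b ⊆ closure (⋃ m, pt m '' Set.Iic (n m))

namespace PartitionSeq

variable {a b : ℝ}

/-- The set `∪λ` of all partition points. -/
def points (lam : PartitionSeq a b) : Set ℝ := ⋃ m, lam.pt m '' Set.Iic (lam.n m)

/-- The point `x_i^m = (t_i^m ∧ t) ∨ s` of the partition of `[s, t]` induced by `λ_m`. -/
def trace (lam : PartitionSeq a b) (s t : ℝ) (m i : ℕ) : ℝ := max (min (lam.pt m i) t) s

end PartitionSeq

/-- `f` is regulated on `[a, b]`: it has finite left limits on `(a, b]` and finite right limits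
on `[a, b)`. -/
def IsRegulated (a b : ℝ) (f : ℝ → ℝ) : Prop :=
  (∀ t ∈ Set.Ioc a b, ∃ l, Tendsto f (𝓝[<] t) (𝓝 l)) ∧
    ∀ s ∈ Set.Ico a b, ∃ r, Tendsto f (𝓝[>] s) (𝓝 r)

/-- `Δ⁻f(t) = f(t) - f(t-)` for `t > a`; it is zero at the left endpoint `a`. -/
noncomputable def jumpLeft (a : ℝ) (f : ℝ → ℝ) (t : ℝ) : ℝ :=
  if a < t then f t - Function.leftLim f t else 0

/-- `Δ⁺f(s) = f(s+) - f(s)` for `s < b`; it is zero at the right endpoint `b`. -/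
noncomputable def jumpRight (b : ℝ) (f : ℝ → ℝ) (s : ℝ) : ℝ :=
  if s < b then Function.rightLim f s - f s else 0

/-- `f ≫ 0` on `[a, b]`. -/
def BoundedAwayPos (a b : ℝ) (f : ℝ → ℝ) : Prop :=
  ∃ C > 0, ∀ t ∈ Set.Icc a b, C ≤ f t

section

variable {a b : ℝ} (lam : PartitionSeq a b)

/-- `V` is a bracket function of `f` along `λ`. -/
def IsBracket (f V : ℝ → ℝ) : Prop :=
  IsRegulated a b V ∧ V a = 0 ∧
    ∀ s t, a ≤ s → s < t → t ≤ b →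
      Tendsto
        (fun m => ∑ i ∈ Finset.range (lam.n m),
          (f (lam.trace s t m (i + 1)) - f (lam.trace s t m i)) ^ 2)
        atTop (𝓝 (V t - V s)) ∧
      jumpLeft a V t = jumpLeft a f t ^ 2 ∧
      jumpRight b V s = jumpRight b f s ^ 2

/-- The class `Q_λ[a, b]` of regulated functions having the quadratic `λ`-variation. -/
def HasQuadVar (f : ℝ → ℝ) : Prop := IsRegulated a b f ∧ ∃ V, IsBracket lam f V

/-- The right discontinuity points of `f` in `(a, b)` are accessible by `λ`. -/
def RightAccessible (f : ℝ → ℝ) : Prop :=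
  {t ∈ Set.Ioo a b | jumpRight b f t ≠ 0} ⊆ lam.points

/-- The class `L_λ[a, b]`. -/
def classL : Set (ℝ → ℝ) :=
  {f | HasQuadVar lam f ∧ f a = 1 ∧ BoundedAwayPos a b f ∧ RightAccessible lam f}

/-- The class `E_λ[a, b]`. -/
def classE : Set (ℝ → ℝ) :=
  {g | HasQuadVar lam g ∧ g a = 0 ∧
    BoundedAwayPos a b (fun t => 1 + min (jumpLeft a g t) (jumpRight b g t)) ∧
    RightAccessible lam g}

/-- `Φ` is an indefinite Left Cauchy `λ`-integral of `g` with respect to `f`. -/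
def IsLCPrimitive (g f Φ : ℝ → ℝ) : Prop :=
  IsRegulated a b Φ ∧ Φ a = 0 ∧
    ∀ s t, a ≤ s → s < t → t ≤ b →
      Tendsto
        (fun m => ∑ i ∈ Finset.range (lam.n m),
          g (lam.trace s t m i) * (f (lam.trace s t m (i + 1)) - f (lam.trace s t m i)))
        atTop (𝓝 (Φ t - Φ s)) ∧
      jumpLeft a Φ t = Function.leftLim g t * jumpLeft a f t ∧
      jumpRight b Φ s = g s * jumpRight b f s

/-- The Left Cauchy `λ`-integral `(LC)∫ g d_λ f` of regulated functions is defined on `[a, b]`. -/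
def LCIntegrable (g f : ℝ → ℝ) : Prop :=
  IsRegulated a b g ∧ IsRegulated a b f ∧ ∃ Φ, IsLCPrimitive lam g f Φ

open Classical in
/-- `(LC)∫_s^t g d_λ f = Φ(t) - Φ(s)`, with the value `0` if the integral is not defined. -/
noncomputable def lcIntegral (g f : ℝ → ℝ) (s t : ℝ) : ℝ :=
  if h : LCIntegrable lam g f then h.2.2.choose t - h.2.2.choose s else 0

/-- `ℒ_λ f` is defined on `[a, b]`. -/
def LogDefined (f : ℝ → ℝ) : Prop := LCIntegrable lam (fun u => (f u)⁻¹) f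

/-- `ℒ_λ f(t) = (LC)∫_a^t f⁻¹ d_λ f`. -/
noncomputable def lambdaLog (f : ℝ → ℝ) (t : ℝ) : ℝ :=
  lcIntegral lam (fun u => (f u)⁻¹) f a t

/-- `H` is an indefinite product `λ`-integral of `f`. -/
def IsProdPrimitive (f H : ℝ → ℝ) : Prop :=
  IsRegulated a b H ∧ H a = 1 ∧ BoundedAwayPos a b (fun t => |H t|) ∧
    ∀ s t, a ≤ s → s < t → t ≤ b →
      Tendsto
        (fun m => ∏ i ∈ Finset.range (lam.n m),
          (1 + f (lam.trace s t m (i + 1)) - f (lam.trace s t m i)))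
        atTop (𝓝 (H t / H s)) ∧
      H t / Function.leftLim H t = 1 + jumpLeft a f t ∧
      Function.rightLim H s / H s = 1 + jumpRight b f s

/-- The product `λ`-integral of `1 + d_λ f` is defined on `[a, b]`. -/
def ProdIntegrable (f : ℝ → ℝ) : Prop :=
  IsRegulated a b f ∧ ∃ H, IsProdPrimitive lam f H

open Classical in
/-- The product `λ`-integral of `1 + d_λ f` over `[s, t]`, that is `H(t) / H(s)`, with the
value `0` if it is not defined. -/
noncomputable def prodIntegral (f : ℝ → ℝ) (s t : ℝ) : ℝ :=
  if h : ProdIntegrable lam f then h.2.choose t / h.2.choose s else 0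

end

/-- `U(t, s)`, `a ≤ s ≤ t ≤ b`, is an evolution in `ℝ`; values at other arguments are ignored. -/
def IsEvolution (a b : ℝ) (U : ℝ → ℝ → ℝ) : Prop :=
  (∀ s t r, a ≤ s → s ≤ t → t ≤ r → r ≤ b → U r t * U t s = U r s) ∧
    ∀ t ∈ Set.Icc a b, U t t = 1

/-- A regulated evolution: `U_a = U(·, a)` is regulated on `[a, b]` and `|U_a| ≫ 0`. -/
def IsRegulatedEvolution (a b : ℝ) (U : ℝ → ℝ → ℝ) : Prop :=
  IsEvolution a b U ∧ IsRegulated a b (fun t => U t a) ∧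
    BoundedAwayPos a b (fun t => |U t a|)

/-- `G` is the `λ`-generator of the regulated evolution `U`. -/
def IsGenerator {a b : ℝ} (lam : PartitionSeq a b) (U : ℝ → ℝ → ℝ) (G : ℝ → ℝ) : Prop :=
  IsRegulated a b G ∧ G a = 0 ∧
    ∀ s t, a ≤ s → s < t → t ≤ b →
      Tendsto
        (fun m => ∑ i ∈ Finset.range (lam.n m),
          (U (lam.trace s t m (i + 1)) (lam.trace s t m i) - 1))
        atTop (𝓝 (G t - G s)) ∧
      jumpLeft a G t = U t a / Function.leftLim (fun u => U u a) t - 1 ∧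
      jumpRight b G s = Function.rightLim (fun u => U u a) s / U s a - 1

/-! Put f = U_a. The evolution identity gives U(v,u) - 1 = (f v - f u)/f u = `relIncr f u v`, and
these are also the terms of the Left Cauchy sums of f⁻¹ against f. Generator and λ-logarithm are
thus one limit Φ. What has to be shown is that this limit exists, and that the second order error
between sums and products is under control.

Existence. The increments of log f telescope, so it suffices to sum x - log(1+x) with x = `relIncr f
u v`. Where x is small this is asymptotic to x²/2, and near a point r, on either side, x² is
asymptotic to a constant multiple of the squared increment of f, whose sums converge by hypothesis.
`exists_tendsto_sumAlong` transfers convergence across such a local comparison: jumps are limits of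
single terms, the rest is compared on one-sided neighbourhoods, and the pieces are glued.
Accessibility of right jumps makes the terms straddling a point converge. The lemma is used twice,
for x² and then for x - log(1+x).

Products. Let g have the jumps prescribed by `HasLogJumps`. The defect d = g v - g u - `relIncr f u
v` has no jumps, so it is uniformly small along λ. Since x - log(1+x) ≥ 0, Φ - log f is
nondecreasing; if g - log f is too, the sums of |d| stay bounded and Σ d² → 0
(`tendsto_sumAlong_defect_sq`). Expanding log(f v/f u + d) and using Cauchy–Schwarz,
`tendsto_prod_one_add` gets ∏(1 + dg) → (f t/f s) exp(g t - g s - (Φ t - Φ s)).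

For g = Φ + c the exponential is 1, which is the product formula. Conversely, if the products tend
to f t/f s, then 1 + x ≤ eˣ makes g - log f nondecreasing, so the same limit is available and forces
g - Φ to be constant. -/

/-! ### Local-to-global induction on subintervals -/

/-- A Cousin-type compactness argument: with c the supremum of the x for which P s x holds, the left
condition at c attains c and the right condition at c passes beyond it, so c = t. This is how
one-sided information at each point is glued below. -/
theorem subinterval_induction {a b : ℝ} {P : ℝ → ℝ → Prop}
    (hadd : ∀ s r t, a ≤ s → s < r → r < t → t ≤ b → P s r → P r t → P s t)
    (hl : ∀ r ∈ Ioc a b, ∀ᶠ s in 𝓝[<] r, a ≤ s → P s r)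
    (hr : ∀ r ∈ Ico a b, ∀ᶠ t in 𝓝[>] r, t ≤ b → P r t)
    {s t : ℝ} (has : a ≤ s) (hst : s < t) (htb : t ≤ b) : P s t := by
  have right : ∀ r, a ≤ r → r < t → ∃ y, r < y ∧ y ≤ t ∧ P r y := by
    intro r har hrt
    have h1 : ∀ᶠ y in 𝓝[>] r, y ∈ Ioc r t := Ioc_mem_nhdsGT hrt
    obtain ⟨y, hy, hP⟩ := (h1.and (hr r ⟨har, hrt.trans_le htb⟩)).exists
    exact ⟨y, hy.1, hy.2, hP (hy.2.trans htb)⟩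
  set A : Set ℝ := {x | s < x ∧ x ≤ t ∧ P s x} with hA
  have hne : A.Nonempty := right s has hst
  have hbdd : BddAbove A := ⟨t, fun x hx => hx.2.1⟩
  set c := sSup A with hc
  have hct : c ≤ t := csSup_le hne fun x hx => hx.2.1
  have hsc : s < c := by
    obtain ⟨x, hx⟩ := hne
    exact hx.1.trans_le (le_csSup hbdd hx)
  have hPc : P s c := by
    obtain ⟨l, hlc, hl'⟩ := mem_nhdsLT_iff_exists_Ioo_subset.1
      (hl c ⟨has.trans_lt hsc, hct.trans htb⟩)
    obtain ⟨x, hxA, hlx⟩ := exists_lt_of_lt_csSup hne hlc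
    rcases (le_csSup hbdd hxA).eq_or_lt with h | h
    · have h' : x = c := h
      exact h' ▸ hxA.2.2
    · exact hadd s x c has hxA.1 h (hct.trans htb) hxA.2.2
        (hl' ⟨hlx, h⟩ (has.trans hxA.1.le))
  rcases hct.eq_or_lt with h | h
  · exact h ▸ hPc
  · obtain ⟨y, hcy, hyt, hP⟩ := right c (has.trans hsc.le) h
    exact absurd (le_csSup hbdd (show y ∈ A from ⟨hsc.trans hcy, hyt,
      hadd s c y has hsc hcy (hyt.trans htb) hPc hP⟩)) (not_le.2 hcy)

/-! ### Partitions, their traces on subintervals, and sums along them -/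

namespace PartitionSeq

variable {a b : ℝ} (lam : PartitionSeq a b)

theorem pt_mono {m i j : ℕ} (hij : i ≤ j) (hj : j ≤ lam.n m) : lam.pt m i ≤ lam.pt m j :=
  (lam.pt_strictMono m).monotoneOn (hij.trans hj) hj hij

theorem image_subset_of_le {m k : ℕ} (h : m ≤ k) :
    lam.pt m '' Iic (lam.n m) ⊆ lam.pt k '' Iic (lam.n k) :=
  monotone_nat_of_le_succ (f := fun m => lam.pt m '' Iic (lam.n m)) lam.nested h

theorem exists_left_index {r : ℝ} (hr : r ∈ Ioc a b) (m : ℕ) :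
    ∃ j < lam.n m, lam.pt m j < r ∧ r ≤ lam.pt m (j + 1) := by
  classical
  have hex : ∃ k, r ≤ lam.pt m k := ⟨lam.n m, by simpa [lam.pt_last] using hr.2⟩
  have h0 : Nat.find hex ≠ 0 := by
    intro h
    have := Nat.find_spec hex
    rw [h, lam.pt_first] at this
    exact absurd hr.1 (not_lt.2 this)
  obtain ⟨j, hj⟩ := Nat.exists_eq_succ_of_ne_zero h0
  have hle : Nat.find hex ≤ lam.n m := Nat.find_min' hex (by simpa [lam.pt_last] using hr.2)
  refine ⟨j, by omega, ?_, ?_⟩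
  · exact not_le.1 (Nat.find_min hex (by omega))
  · have := Nat.find_spec hex
    rwa [hj] at this

theorem exists_right_index {r : ℝ} (hr : r ∈ Ico a b) (m : ℕ) :
    ∃ j < lam.n m, lam.pt m j ≤ r ∧ r < lam.pt m (j + 1) := by
  classical
  have hex : ∃ k, r < lam.pt m k := ⟨lam.n m, by simpa [lam.pt_last] using hr.2⟩
  have h0 : Nat.find hex ≠ 0 := by
    intro h
    have := Nat.find_spec hex
    rw [h, lam.pt_first] at this
    exact absurd hr.1 (not_le.2 this)
  obtain ⟨j, hj⟩ := Nat.exists_eq_succ_of_ne_zero h0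
  have hle : Nat.find hex ≤ lam.n m := Nat.find_min' hex (by simpa [lam.pt_last] using hr.2)
  refine ⟨j, by omega, ?_, ?_⟩
  · exact not_lt.1 (Nat.find_min hex (by omega))
  · have := Nat.find_spec hex
    rwa [hj] at this

/-- Density supplies the point, and nestedness keeps it in every later partition. -/
theorem exists_point_between {c d : ℝ} (hc : a ≤ c) (hd : d ≤ b) (hcd : c < d) :
    ∃ p ∈ Ioo c d, ∃ M, ∀ m ≥ M, ∃ i ≤ lam.n m, lam.pt m i = p := by
  obtain ⟨x, hx⟩ := nonempty_Ioo.2 hcd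
  obtain ⟨p, hp, hpm⟩ := mem_closure_iff.1 (lam.dense ⟨hc.trans hx.1.le, hx.2.le.trans hd⟩)
    (Ioo c d) isOpen_Ioo hx
  obtain ⟨M, hM⟩ := mem_iUnion.1 hpm
  exact ⟨p, hp, M, fun m hm => lam.image_subset_of_le hm hM⟩

theorem eventually_mem_of_mem_points {r : ℝ} (hr : r ∈ lam.points) :
    ∀ᶠ m in atTop, ∃ i ≤ lam.n m, lam.pt m i = r := by
  obtain ⟨M, hM⟩ := mem_iUnion.1 hr
  exact eventually_atTop.2 ⟨M, fun m hm => lam.image_subset_of_le hm hM⟩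

/-- A partition point placed just before r persists, so from some m on the last point of λ_m before
r lies at or beyond it. -/
theorem tendsto_left {r : ℝ} (hr : r ∈ Ioc a b) {j : ℕ → ℕ} (hj : ∀ m, j m < lam.n m)
    (h1 : ∀ m, lam.pt m (j m) < r) (h2 : ∀ m, r ≤ lam.pt m (j m + 1)) :
    Tendsto (fun m => lam.pt m (j m)) atTop (𝓝[<] r) := by
  refine tendsto_nhdsWithin_iff.2 ⟨?_, Eventually.of_forall h1⟩
  refine tendsto_order.2 ⟨fun c hc => ?_, fun c hc => Eventually.of_forall fun m => (h1 m).trans hc⟩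
  obtain ⟨p, hp, M, hM⟩ := lam.exists_point_between (le_max_right c a) hr.2 (max_lt hc hr.1)
  refine eventually_atTop.2 ⟨M, fun m hm => ?_⟩
  obtain ⟨i, hi, rfl⟩ := hM m hm
  have hij : i ≤ j m := by
    by_contra h
    exact absurd ((h2 m).trans (lam.pt_mono (by omega) hi)) (not_le.2 hp.2)
  exact (le_max_left c a).trans_lt (hp.1.trans_le (lam.pt_mono hij (hj m).le))

theorem tendsto_right {r : ℝ} (hr : r ∈ Ico a b) {j : ℕ → ℕ} (hj : ∀ m, j m < lam.n m)
    (h1 : ∀ m, lam.pt m (j m) ≤ r) (h2 : ∀ m, r < lam.pt m (j m + 1)) :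
    Tendsto (fun m => lam.pt m (j m + 1)) atTop (𝓝[>] r) := by
  refine tendsto_nhdsWithin_iff.2 ⟨?_, Eventually.of_forall h2⟩
  refine tendsto_order.2 ⟨fun c hc => Eventually.of_forall fun m => hc.trans (h2 m), fun c hc => ?_⟩
  obtain ⟨p, hp, M, hM⟩ := lam.exists_point_between hr.1 (min_le_right c b) (lt_min hc hr.2)
  refine eventually_atTop.2 ⟨M, fun m hm => ?_⟩
  obtain ⟨i, hi, rfl⟩ := hM m hm
  have hij : j m + 1 ≤ i := by
    by_contra h
    exact absurd ((lam.pt_mono (by omega) (hj m).le).trans (h1 m)) (not_le.2 hp.1)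
  exact (lam.pt_mono hij hi).trans_lt (hp.2.trans_le (min_le_left c b))

theorem trace_mono {s t : ℝ} {m i j : ℕ} (hij : i ≤ j) (hj : j ≤ lam.n m) :
    lam.trace s t m i ≤ lam.trace s t m j :=
  max_le_max (min_le_min (lam.pt_mono hij hj) le_rfl) le_rfl

theorem trace_mem_Icc {s t : ℝ} (hst : s ≤ t) (m i : ℕ) : lam.trace s t m i ∈ Icc s t :=
  ⟨le_max_right _ _, max_le (min_le_right _ _) hst⟩

theorem trace_zero {s t : ℝ} (hs : a ≤ s) (m : ℕ) : lam.trace s t m 0 = s :=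
  max_eq_right ((min_le_left _ _).trans (by rwa [lam.pt_first]))

theorem trace_last {s t : ℝ} (hst : s ≤ t) (ht : t ≤ b) (m : ℕ) :
    lam.trace s t m (lam.n m) = t := by
  rw [trace, lam.pt_last, min_eq_right ht, max_eq_left hst]

theorem trace_of_le {s r t : ℝ} (hrt : r ≤ t) {m i : ℕ} (hi : lam.pt m i ≤ r) :
    lam.trace s t m i = lam.trace s r m i := by
  rw [trace, trace, min_eq_left hi, min_eq_left (hi.trans hrt)]

theorem trace_of_ge {s r t : ℝ} (hsr : s ≤ r) (hrt : r ≤ t) {m i : ℕ} (hi : r ≤ lam.pt m i) :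
    lam.trace s t m i = lam.trace r t m i := by
  have : r ≤ min (lam.pt m i) t := le_min hi hrt
  rw [trace, trace, max_eq_left this, max_eq_left (hsr.trans this)]

theorem trace_eq_left {s t : ℝ} {m i : ℕ} (hi : lam.pt m i ≤ s) : lam.trace s t m i = s :=
  max_eq_right ((min_le_left _ _).trans hi)

theorem trace_eq_right {s t : ℝ} (hst : s ≤ t) {m i : ℕ} (hi : t ≤ lam.pt m i) :
    lam.trace s t m i = t := by
  rw [trace, min_eq_right hi, max_eq_left hst]

/-- The sum of the interval function `G` over the partition of `[s, t]` induced by `λ_m`. -/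
noncomputable def sumAlong (G : ℝ → ℝ → ℝ) (s t : ℝ) (m : ℕ) : ℝ :=
  ∑ i ∈ Finset.range (lam.n m), G (lam.trace s t m i) (lam.trace s t m (i + 1))

theorem sumAlong_add (G K : ℝ → ℝ → ℝ) (s t : ℝ) (m : ℕ) :
    lam.sumAlong (fun u v => G u v + K u v) s t m = lam.sumAlong G s t m + lam.sumAlong K s t m :=
  Finset.sum_add_distrib

theorem sumAlong_sub (G K : ℝ → ℝ → ℝ) (s t : ℝ) (m : ℕ) :
    lam.sumAlong (fun u v => G u v - K u v) s t m = lam.sumAlong G s t m - lam.sumAlong K s t m :=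
  Finset.sum_sub_distrib _ _

theorem sumAlong_increment (f : ℝ → ℝ) {s t : ℝ} (hs : a ≤ s) (hst : s ≤ t) (ht : t ≤ b) (m : ℕ) :
    lam.sumAlong (fun u v => f v - f u) s t m = f t - f s := by
  unfold sumAlong
  rw [Finset.sum_range_sub (fun i => f (lam.trace s t m i)), lam.trace_zero hs,
    lam.trace_last hst ht]

theorem sumAlong_nonneg {G : ℝ → ℝ → ℝ} {s t : ℝ} (hst : s ≤ t) (m : ℕ)
    (hG : ∀ u v, s ≤ u → u ≤ v → v ≤ t → 0 ≤ G u v) : 0 ≤ lam.sumAlong G s t m :=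
  Finset.sum_nonneg fun i hi => hG _ _ (lam.trace_mem_Icc hst m i).1
    (lam.trace_mono (Nat.le_succ i) (Finset.mem_range.1 hi)) (lam.trace_mem_Icc hst m (i + 1)).2

end PartitionSeq

/-! ### Admissible interval functions -/

theorem exists_Ioo_of_eventually_nhdsLT_prod {r : ℝ} {p : ℝ → ℝ → Prop}
    (h : ∀ᶠ x in 𝓝[<] r ×ˢ 𝓝[<] r, p x.1 x.2) : ∃ c < r, ∀ u ∈ Ioo c r, ∀ v ∈ Ioo c r, p u v := by
  obtain ⟨T, hT, hp⟩ := eventually_prod_self_iff.1 h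
  obtain ⟨c, hc, hcT⟩ := mem_nhdsLT_iff_exists_Ioo_subset.1 hT
  exact ⟨c, hc, fun u hu v hv => hp u (hcT hu) v (hcT hv)⟩

theorem exists_Ioo_of_eventually_nhdsGT_prod {r : ℝ} {p : ℝ → ℝ → Prop}
    (h : ∀ᶠ x in 𝓝[>] r ×ˢ 𝓝[>] r, p x.1 x.2) : ∃ c > r, ∀ u ∈ Ioo r c, ∀ v ∈ Ioo r c, p u v := by
  obtain ⟨T, hT, hp⟩ := eventually_prod_self_iff.1 h
  obtain ⟨c, hc, hcT⟩ := mem_nhdsGT_iff_exists_Ioo_subset.1 hT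
  exact ⟨c, hc, fun u hu v hv => hp u (hcT hu) v (hcT hv)⟩

namespace PartitionSeq

variable {a b : ℝ} (lam : PartitionSeq a b)

/-- The interval function `G` has the one-sided limits `G(r-, r) = gl r` and `G(r, r+) = gr r`,
it is small on short intervals on either side of a point, and across a point not accessible
by `λ` it behaves as if there were no right jump. -/
structure IsAdmissible (G : ℝ → ℝ → ℝ) (gl gr : ℝ → ℝ) : Prop where
  diag : ∀ u, G u u = 0
  left : ∀ r ∈ Ioc a b, Tendsto (fun u => G u r) (𝓝[<] r) (𝓝 (gl r))
  right : ∀ r ∈ Ico a b, Tendsto (fun v => G r v) (𝓝[>] r) (𝓝 (gr r))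
  near_left : ∀ r ∈ Ioc a b, Tendsto (fun p : ℝ × ℝ => G p.1 p.2) (𝓝[<] r ×ˢ 𝓝[<] r) (𝓝 0)
  near_right : ∀ r ∈ Ico a b, Tendsto (fun p : ℝ × ℝ => G p.1 p.2) (𝓝[>] r ×ˢ 𝓝[>] r) (𝓝 0)
  cross : ∀ r ∈ Ioo a b, r ∉ lam.points →
    Tendsto (fun p : ℝ × ℝ => G p.1 p.2) (𝓝[<] r ×ˢ 𝓝[>] r) (𝓝 (gl r)) ∧ gr r = 0

variable {lam} {G K Q : ℝ → ℝ → ℝ} {gl gr kl kr ql qr : ℝ → ℝ}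

theorem IsAdmissible.sub (hG : lam.IsAdmissible G gl gr) (hK : lam.IsAdmissible K kl kr) :
    lam.IsAdmissible (fun u v => G u v - K u v) (fun r => gl r - kl r) (fun r => gr r - kr r) where
  diag u := by rw [hG.diag, hK.diag, sub_zero]
  left r hr := (hG.left r hr).sub (hK.left r hr)
  right r hr := (hG.right r hr).sub (hK.right r hr)
  near_left r hr := by simpa using (hG.near_left r hr).sub (hK.near_left r hr)
  near_right r hr := by simpa using (hG.near_right r hr).sub (hK.near_right r hr)
  cross r hr h := ⟨(hG.cross r hr h).1.sub (hK.cross r hr h).1, by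
    rw [(hG.cross r hr h).2, (hK.cross r hr h).2, sub_zero]⟩

theorem IsAdmissible.congr (hG : lam.IsAdmissible G gl gr) (hl : ∀ r ∈ Ioc a b, gl r = kl r)
    (hr : ∀ r ∈ Ico a b, gr r = kr r) : lam.IsAdmissible G kl kr where
  diag := hG.diag
  left r h := hl r h ▸ hG.left r h
  right r h := hr r h ▸ hG.right r h
  near_left := hG.near_left
  near_right := hG.near_right
  cross r h hn := by
    rw [← hl r ⟨h.1, h.2.le⟩, ← hr r ⟨h.1.le, h.2⟩]
    exact hG.cross r h hn

/-- The increments of a regulated function whose right jumps are accessible. -/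
theorem isAdmissible_increment {g : ℝ → ℝ} {g₁ g₂ : ℝ → ℝ}
    (h₁ : ∀ r ∈ Ioc a b, Tendsto g (𝓝[<] r) (𝓝 (g₁ r)))
    (h₂ : ∀ r ∈ Ico a b, Tendsto g (𝓝[>] r) (𝓝 (g₂ r)))
    (h₃ : ∀ r ∈ Ioo a b, r ∉ lam.points → g₂ r = g r) :
    lam.IsAdmissible (fun u v => g v - g u) (fun r => g r - g₁ r) (fun r => g₂ r - g r) where
  diag u := sub_self _
  left r hr := tendsto_const_nhds.sub (h₁ r hr)
  right r hr := (h₂ r hr).sub tendsto_const_nhds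
  near_left r hr := by
    simpa using ((h₁ r hr).comp tendsto_snd).sub ((h₁ r hr).comp tendsto_fst)
  near_right r hr := by
    simpa using ((h₂ r hr).comp tendsto_snd).sub ((h₂ r hr).comp tendsto_fst)
  cross r hr hn := by
    refine ⟨?_, by rw [h₃ r hr hn, sub_self]⟩
    have := h₂ r ⟨hr.1.le, hr.2⟩
    rw [h₃ r hr hn] at this
    exact (this.comp tendsto_snd).sub ((h₁ r ⟨hr.1, hr.2.le⟩).comp tendsto_fst)

/-- A function of two values of a positive regulated function. -/
theorem isAdmissible_comp {f f₁ f₂ : ℝ → ℝ} {F : ℝ → ℝ → ℝ}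
    (h₁ : ∀ r ∈ Ioc a b, Tendsto f (𝓝[<] r) (𝓝 (f₁ r)) ∧ 0 < f₁ r)
    (h₂ : ∀ r ∈ Ico a b, Tendsto f (𝓝[>] r) (𝓝 (f₂ r)) ∧ 0 < f₂ r)
    (h₃ : ∀ r ∈ Ioo a b, r ∉ lam.points → f₂ r = f r)
    (hf : ∀ r ∈ Icc a b, 0 < f r) (hF₀ : ∀ x, F x x = 0)
    (hF : ∀ x y, 0 < x → 0 < y → ContinuousAt (fun p : ℝ × ℝ => F p.1 p.2) (x, y)) :
    lam.IsAdmissible (fun u v => F (f u) (f v)) (fun r => F (f₁ r) (f r))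
      (fun r => F (f r) (f₂ r)) where
  diag u := hF₀ _
  left r hr := (hF _ _ (h₁ r hr).2 (hf r ⟨hr.1.le, hr.2⟩)).tendsto.comp
    ((h₁ r hr).1.prodMk_nhds tendsto_const_nhds)
  right r hr := (hF _ _ (hf r ⟨hr.1, hr.2.le⟩) (h₂ r hr).2).tendsto.comp
    (tendsto_const_nhds.prodMk_nhds (h₂ r hr).1)
  near_left r hr := by
    rw [← hF₀ (f₁ r)]
    exact (hF _ _ (h₁ r hr).2 (h₁ r hr).2).tendsto.comp
      (((h₁ r hr).1.comp tendsto_fst).prodMk_nhds ((h₁ r hr).1.comp tendsto_snd))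
  near_right r hr := by
    rw [← hF₀ (f₂ r)]
    exact (hF _ _ (h₂ r hr).2 (h₂ r hr).2).tendsto.comp
      (((h₂ r hr).1.comp tendsto_fst).prodMk_nhds ((h₂ r hr).1.comp tendsto_snd))
  cross r hr hn := by
    refine ⟨?_, by rw [h₃ r hr hn, hF₀]⟩
    have h₁' := h₁ r ⟨hr.1, hr.2.le⟩
    have h₂' := (h₂ r ⟨hr.1.le, hr.2⟩).1
    rw [h₃ r hr hn] at h₂'
    exact (hF _ _ h₁'.2 (hf r ⟨hr.1.le, hr.2.le⟩)).tendsto.comp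
      ((h₁'.1.comp tendsto_fst).prodMk_nhds (h₂'.comp tendsto_snd))

theorem tendsto_max_left {s r : ℝ} (hsr : s < r) {x : ℕ → ℝ} (hx : Tendsto x atTop (𝓝[<] r)) :
    Tendsto (fun m => max (x m) s) atTop (𝓝[<] r) := by
  obtain ⟨h1, h2⟩ := tendsto_nhdsWithin_iff.1 hx
  refine tendsto_nhdsWithin_iff.2 ⟨?_, h2.mono fun m hm => max_lt hm hsr⟩
  simpa [max_eq_left hsr.le] using h1.max (tendsto_const_nhds (x := s))

theorem tendsto_min_right {r t : ℝ} (hrt : r < t) {x : ℕ → ℝ} (hx : Tendsto x atTop (𝓝[>] r)) :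
    Tendsto (fun m => min (x m) t) atTop (𝓝[>] r) := by
  obtain ⟨h1, h2⟩ := tendsto_nhdsWithin_iff.1 hx
  refine tendsto_nhdsWithin_iff.2 ⟨?_, h2.mono fun m hm => lt_min hm hrt⟩
  simpa [min_eq_left hrt.le] using h1.min (tendsto_const_nhds (x := t))

/-- Limits of an admissible interval function along the intervals of `λ_m` containing `r`. -/
theorem IsAdmissible.tendsto_cross (hG : lam.IsAdmissible G gl gr) {s r t : ℝ} (hs : a ≤ s)
    (hsr : s < r) (hrt : r < t) (ht : t ≤ b) {j : ℕ → ℕ} (hj : ∀ m, j m < lam.n m)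
    (h1 : ∀ m, lam.pt m (j m) < r) (h2 : ∀ m, r ≤ lam.pt m (j m + 1)) :
    Tendsto (fun m => G (max (lam.pt m (j m)) s) r) atTop (𝓝 (gl r)) ∧
    Tendsto (fun m => G r (min (lam.pt m (j m + 1)) t)) atTop (𝓝 0) ∧
    Tendsto (fun m => G (max (lam.pt m (j m)) s) (min (lam.pt m (j m + 1)) t)) atTop
      (𝓝 (gl r)) := by
  have hr : r ∈ Ioc a b := ⟨hs.trans_lt hsr, hrt.le.trans ht⟩
  have hu := tendsto_max_left hsr (lam.tendsto_left hr hj h1 h2)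
  have hl := (hG.left r hr).comp hu
  refine ⟨hl, ?_⟩
  -- An accessible r is eventually itself a partition point, so nothing of the interval remains to
  -- its right. At an inaccessible r the intervals really straddle r, and the `cross` condition
  -- applies.
  by_cases hp : r ∈ lam.points
  · have hv : ∀ᶠ m in atTop, min (lam.pt m (j m + 1)) t = r := by
      filter_upwards [lam.eventually_mem_of_mem_points hp] with m hm
      obtain ⟨i, hi, hir⟩ := hm
      have : j m + 1 ≤ i := by
        by_contra h
        exact absurd (hir ▸ lam.pt_mono (show i ≤ j m by omega) (hj m).le) (not_le.2 (h1 m))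
      have h3 : lam.pt m (j m + 1) = r :=
        le_antisymm (hir ▸ lam.pt_mono this hi) (h2 m)
      rw [h3, min_eq_left hrt.le]
    constructor
    · refine (tendsto_const_nhds (x := (0 : ℝ))).congr' ?_
      filter_upwards [hv] with m hm
      rw [hm, hG.diag]
    · refine hl.congr' ?_
      filter_upwards [hv] with m hm
      simp only [Function.comp_apply, hm]
  · have hr' : r ∈ Ioo a b := ⟨hr.1, hrt.trans_le ht⟩
    have h2' : ∀ m, r < lam.pt m (j m + 1) := fun m => (h2 m).lt_of_ne fun h =>
      hp (mem_iUnion.2 ⟨m, j m + 1, hj m, h.symm⟩)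
    have hv := tendsto_min_right hrt
      (lam.tendsto_right ⟨hr'.1.le, hr'.2⟩ hj (fun m => (h1 m).le) h2')
    obtain ⟨hc, h0⟩ := hG.cross r hr' hp
    refine ⟨?_, hc.comp (hu.prodMk hv)⟩
    have := (hG.right r ⟨hr'.1.le, hr'.2⟩).comp hv
    rwa [h0] at this

/-- Away from the interval containing r, each term is unchanged in the sum on its own side of r and
degenerate in the other, where it contributes G u u = 0. -/
theorem sumAlong_split (h0 : ∀ u, G u u = 0) {s r t : ℝ} (hsr : s < r) (hrt : r < t)
    {m j : ℕ} (hj : j < lam.n m) (h1 : lam.pt m j < r) (h2 : r ≤ lam.pt m (j + 1)) :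
    lam.sumAlong G s t m - lam.sumAlong G s r m - lam.sumAlong G r t m =
      G (max (lam.pt m j) s) (min (lam.pt m (j + 1)) t) - G (max (lam.pt m j) s) r
        - G r (min (lam.pt m (j + 1)) t) := by
  unfold sumAlong
  rw [← Finset.sum_sub_distrib, ← Finset.sum_sub_distrib, Finset.sum_eq_single j]
  · have e1 : lam.trace s t m j = max (lam.pt m j) s := by
      rw [trace, min_eq_left (h1.le.trans hrt.le)]
    have e3 : r ≤ min (lam.pt m (j + 1)) t := le_min h2 hrt.le
    have e2 : lam.trace s t m (j + 1) = min (lam.pt m (j + 1)) t := by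
      rw [trace, max_eq_left (hsr.le.trans e3)]
    rw [← lam.trace_of_le hrt.le h1.le, ← lam.trace_of_ge hsr.le hrt.le h2, e1, e2,
      lam.trace_eq_left h1.le, lam.trace_eq_right hsr.le h2]
  · intro i hi hij
    have hi' := Finset.mem_range.1 hi
    rcases lt_or_gt_of_ne hij with h | h
    · have a1 : lam.pt m i ≤ r := (lam.pt_mono h.le hj.le).trans h1.le
      have a2 : lam.pt m (i + 1) ≤ r := (lam.pt_mono h hj.le).trans h1.le
      rw [lam.trace_of_le hrt.le a1, lam.trace_of_le hrt.le a2, lam.trace_eq_left a1,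
        lam.trace_eq_left a2, h0]
      ring
    · have a1 : r ≤ lam.pt m i := h2.trans (lam.pt_mono h hi'.le)
      have a2 : r ≤ lam.pt m (i + 1) := a1.trans (lam.pt_mono (Nat.le_succ i) hi')
      rw [lam.trace_of_ge hsr.le hrt.le a1, lam.trace_of_ge hsr.le hrt.le a2,
        lam.trace_eq_right hsr.le a1, lam.trace_eq_right hsr.le a2, h0]
      ring
  · intro h
    exact absurd (Finset.mem_range.2 hj) h

/-- The three terms left at r tend to `gl r`, `gl r` and 0, so the sums are additive in the limit.
-/
theorem IsAdmissible.tendsto_sumAlong_split (hG : lam.IsAdmissible G gl gr) {s r t : ℝ}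
    (hs : a ≤ s) (hsr : s < r) (hrt : r < t) (ht : t ≤ b) :
    Tendsto (fun m => lam.sumAlong G s t m - lam.sumAlong G s r m - lam.sumAlong G r t m) atTop
      (𝓝 0) := by
  choose j hj h1 h2 using
    lam.exists_left_index (r := r) ⟨hs.trans_lt hsr, hrt.le.trans ht⟩
  obtain ⟨c1, c2, c3⟩ := hG.tendsto_cross hs hsr hrt ht hj h1 h2
  have := (c3.sub c1).sub c2
  rw [sub_self, sub_zero] at this
  exact this.congr fun m => (sumAlong_split hG.diag hsr hrt (hj m) (h1 m) (h2 m)).symm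

/-- Only the j-th interval joins a point before r to r itself. The others lie in [s, r), where the
comparison holds, or are degenerate, so the jump at r is isolated in a single term. -/
theorem abs_sumAlong_sub_last_le (hG : ∀ u, G u u = 0) (hQ : ∀ u, Q u u = 0) {s r : ℝ}
    (hsr : s < r) (hle : ∀ u v, s ≤ u → u < r → s ≤ v → v < r → |G u v| ≤ Q u v)
    {m j : ℕ} (hj : j < lam.n m) (h1 : lam.pt m j < r) (h2 : r ≤ lam.pt m (j + 1)) :
    |lam.sumAlong G s r m - G (max (lam.pt m j) s) r| ≤
      lam.sumAlong Q s r m - Q (max (lam.pt m j) s) r := by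
  have e1 : lam.trace s r m j = max (lam.pt m j) s := by rw [trace, min_eq_left h1.le]
  have hj' := Finset.mem_range.2 hj
  unfold sumAlong
  rw [← Finset.add_sum_erase _ _ hj', ← Finset.add_sum_erase _ (fun i => Q _ _) hj', e1,
    lam.trace_eq_right hsr.le h2, add_sub_cancel_left, add_sub_cancel_left]
  refine (Finset.abs_sum_le_sum_abs _ _).trans (Finset.sum_le_sum fun i hi => ?_)
  obtain ⟨hij, hi⟩ := Finset.mem_erase.1 hi
  have hi' := Finset.mem_range.1 hi
  rcases lt_or_gt_of_ne hij with h | h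
  · have lt : ∀ k ≤ j, lam.trace s r m k < r := fun k hk => max_lt
      ((min_le_left _ _).trans_lt ((lam.pt_mono hk hj.le).trans_lt h1)) hsr
    exact hle _ _ (le_max_right _ _) (lt i h.le) (le_max_right _ _) (lt (i + 1) h)
  · have a1 : r ≤ lam.pt m i := h2.trans (lam.pt_mono h hi'.le)
    have a2 : r ≤ lam.pt m (i + 1) := a1.trans (lam.pt_mono (Nat.le_succ i) hi')
    rw [lam.trace_eq_right hsr.le a1, lam.trace_eq_right hsr.le a2, hG, hQ, abs_zero]

theorem abs_sumAlong_sub_first_le (hG : ∀ u, G u u = 0) (hQ : ∀ u, Q u u = 0) {r t : ℝ}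
    (hrt : r < t) (hle : ∀ u v, r < u → u ≤ t → r < v → v ≤ t → |G u v| ≤ Q u v)
    {m j : ℕ} (hj : j < lam.n m) (h1 : lam.pt m j ≤ r) (h2 : r < lam.pt m (j + 1)) :
    |lam.sumAlong G r t m - G r (min (lam.pt m (j + 1)) t)| ≤
      lam.sumAlong Q r t m - Q r (min (lam.pt m (j + 1)) t) := by
  have e1 : lam.trace r t m (j + 1) = min (lam.pt m (j + 1)) t := by
    rw [trace, max_eq_left (le_min h2.le hrt.le)]
  have hj' := Finset.mem_range.2 hj
  unfold sumAlong
  rw [← Finset.add_sum_erase _ _ hj', ← Finset.add_sum_erase _ (fun i => Q _ _) hj', e1,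
    lam.trace_eq_left h1, add_sub_cancel_left, add_sub_cancel_left]
  refine (Finset.abs_sum_le_sum_abs _ _).trans (Finset.sum_le_sum fun i hi => ?_)
  obtain ⟨hij, hi⟩ := Finset.mem_erase.1 hi
  have hi' := Finset.mem_range.1 hi
  rcases lt_or_gt_of_ne hij with h | h
  · have a1 : lam.pt m i ≤ r := (lam.pt_mono h.le hj.le).trans h1
    have a2 : lam.pt m (i + 1) ≤ r := (lam.pt_mono h hj.le).trans h1
    rw [lam.trace_eq_left a1, lam.trace_eq_left a2, hG, hQ, abs_zero]
  · have gt : ∀ k, j + 1 ≤ k → k ≤ lam.n m → r < lam.trace r t m k := fun k hk hk' =>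
      lt_max_of_lt_left (lt_min (h2.trans_le (lam.pt_mono hk hk')) hrt)
    exact hle _ _ (gt i h hi'.le) (lam.trace_mem_Icc hrt.le m i).2
      (gt (i + 1) (by omega) hi') (lam.trace_mem_Icc hrt.le m (i + 1)).2

/-- An admissible interval function without jumps is uniformly small along `λ`. -/
theorem IsAdmissible.eventually_abs_le (hG : lam.IsAdmissible G (fun _ => 0) (fun _ => 0))
    {ε : ℝ} (hε : 0 < ε) {s t : ℝ} (hs : a ≤ s) (hst : s < t) (ht : t ≤ b) :
    ∀ᶠ m in atTop, ∀ i < lam.n m, |G (lam.trace s t m i) (lam.trace s t m (i + 1))| ≤ ε := by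
  have small : ∀ {α : Type} {l : Filter α} {x : α → ℝ}, Tendsto x l (𝓝 0) →
      ∀ᶠ y in l, |x y| ≤ ε := fun h =>
    (((tendsto_zero_iff_abs_tendsto_zero _).1 h).eventually (gt_mem_nhds hε)).mono fun _ h => h.le
  refine subinterval_induction (P := fun s t => ∀ᶠ m in atTop, ∀ i < lam.n m,
    |G (lam.trace s t m i) (lam.trace s t m (i + 1))| ≤ ε) ?_ ?_ ?_ hs hst ht
  · intro s r t hs hsr hrt ht h1 h2
    choose j hj hj1 hj2 using
      lam.exists_left_index (r := r) ⟨hs.trans_lt hsr, hrt.le.trans ht⟩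
    have hc := small (hG.tendsto_cross hs hsr hrt ht hj hj1 hj2).2.2
    filter_upwards [h1, h2, hc] with m h1 h2 hc i hi
    rcases lt_trichotomy i (j m) with h | h | h
    · have a1 : lam.pt m i ≤ r := (lam.pt_mono h.le (hj m).le).trans (hj1 m).le
      have a2 : lam.pt m (i + 1) ≤ r := (lam.pt_mono h (hj m).le).trans (hj1 m).le
      rw [lam.trace_of_le hrt.le a1, lam.trace_of_le hrt.le a2]
      exact h1 i hi
    · subst h
      have e1 : lam.trace s t m (j m) = max (lam.pt m (j m)) s := by
        rw [trace, min_eq_left ((hj1 m).le.trans hrt.le)]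
      have e2 : lam.trace s t m (j m + 1) = min (lam.pt m (j m + 1)) t := by
        rw [trace, max_eq_left (hsr.le.trans (le_min (hj2 m) hrt.le))]
      rwa [e1, e2]
    · have a1 : r ≤ lam.pt m i := (hj2 m).trans (lam.pt_mono h hi.le)
      have a2 : r ≤ lam.pt m (i + 1) := a1.trans (lam.pt_mono (Nat.le_succ i) hi)
      rw [lam.trace_of_ge hsr.le hrt.le a1, lam.trace_of_ge hsr.le hrt.le a2]
      exact h2 i hi
  · intro r hr
    obtain ⟨c, hc, hcG⟩ := exists_Ioo_of_eventually_nhdsLT_prod (p := fun u v => |G u v| ≤ ε)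
      (small (hG.near_left r hr))
    obtain ⟨d, hd, hdG⟩ := mem_nhdsLT_iff_exists_Ioo_subset.1 (small (hG.left r hr))
    filter_upwards [Ioo_mem_nhdsLT (max_lt hc hd)] with s hs _
    refine Eventually.of_forall fun m i hi => ?_
    obtain ⟨x1, x2⟩ := lam.trace_mem_Icc hs.2.le m i
    obtain ⟨y1, y2⟩ := lam.trace_mem_Icc hs.2.le m (i + 1)
    have hxy := lam.trace_mono (s := s) (t := r) (Nat.le_succ i) hi
    generalize lam.trace s r m i = x at *
    generalize lam.trace s r m (i + 1) = y at *
    have hcs := (le_max_left c d).trans_lt hs.1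
    have hds := (le_max_right c d).trans_lt hs.1
    rcases y2.eq_or_lt with rfl | hy
    · rcases x2.eq_or_lt with rfl | hx
      · rw [hG.diag, abs_zero]; exact hε.le
      · exact hdG ⟨hds.trans_le x1, hx⟩
    · exact hcG x ⟨hcs.trans_le x1, hxy.trans_lt hy⟩ y ⟨hcs.trans_le y1, hy⟩
  · intro r hr
    obtain ⟨c, hc, hcG⟩ := exists_Ioo_of_eventually_nhdsGT_prod (p := fun u v => |G u v| ≤ ε)
      (small (hG.near_right r hr))
    obtain ⟨d, hd, hdG⟩ := mem_nhdsGT_iff_exists_Ioo_subset.1 (small (hG.right r hr))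
    filter_upwards [Ioo_mem_nhdsGT (lt_min hc hd)] with t ht _
    refine Eventually.of_forall fun m i hi => ?_
    obtain ⟨x1, x2⟩ := lam.trace_mem_Icc ht.1.le m i
    obtain ⟨y1, y2⟩ := lam.trace_mem_Icc ht.1.le m (i + 1)
    have hxy := lam.trace_mono (s := r) (t := t) (Nat.le_succ i) hi
    generalize lam.trace r t m i = x at *
    generalize lam.trace r t m (i + 1) = y at *
    have hcs := ht.2.trans_le (min_le_left c d)
    have hds := ht.2.trans_le (min_le_right c d)
    rcases x1.eq_or_lt with rfl | hx
    · rcases y1.eq_or_lt with rfl | hy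
      · rw [hG.diag, abs_zero]; exact hε.le
      · exact hdG ⟨hy, y2.trans_lt hds⟩
    · exact hcG x ⟨hx, x2.trans_lt hcs⟩ y ⟨hx.trans_le hxy, y2.trans_lt hcs⟩

end PartitionSeq

/-! ### Convergence of sums by local comparison -/

namespace PartitionSeq

variable {a b : ℝ} {lam : PartitionSeq a b} {G Q : ℝ → ℝ → ℝ} {gl gr ql qr V : ℝ → ℝ}

variable (lam) in
theorem sumAlong_mul (c : ℝ) (G : ℝ → ℝ → ℝ) (s t : ℝ) (m : ℕ) :
    lam.sumAlong (fun u v => c * G u v) s t m = c * lam.sumAlong G s t m :=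
  (Finset.mul_sum _ _ _).symm

/-- The sequence `e` is not known to converge, so the limit is taken only in the bound, at the price
of δ. -/
theorem eventually_abs_sub_le_of_tendsto {S q g e : ℕ → ℝ} {v l κ η δ : ℝ} {x : ℝ}
    (hS : Tendsto S atTop (𝓝 v)) (hq : Tendsto q atTop (𝓝 x)) (hg : Tendsto g atTop (𝓝 l))
    (he : ∀ m, |e m - κ * S m - (g m - κ * q m)| ≤ η * S m - η * q m) (hδ : 0 < δ) :
    ∀ᶠ m in atTop, |e m - (l + κ * (v - x))| ≤ η * (v - x) + δ := by
  have h1 : Tendsto (fun m => η * S m - η * q m + |κ * S m - κ * q m + g m - (l + κ * (v - x))|)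
      atTop (𝓝 (η * v - η * x + |κ * v - κ * x + l - (l + κ * (v - x))|)) :=
    ((hS.const_mul η).sub (hq.const_mul η)).add
      (((((hS.const_mul κ).sub (hq.const_mul κ)).add hg).sub tendsto_const_nhds).abs)
  have h2 : η * v - η * x + |κ * v - κ * x + l - (l + κ * (v - x))| = η * (v - x) := by
    rw [show κ * v - κ * x + l - (l + κ * (v - x)) = 0 by ring, abs_zero]; ring
  rw [h2] at h1
  filter_upwards [h1.eventually (gt_mem_nhds (lt_add_of_pos_right _ hδ))] with m hm
  refine le_trans ?_ hm.le
  calc |e m - (l + κ * (v - x))|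
      = |(e m - κ * S m - (g m - κ * q m)) + (κ * S m - κ * q m + g m - (l + κ * (v - x)))| := by
        congr 1; ring
    _ ≤ _ := (abs_add_le _ _).trans (add_le_add (he m) le_rfl)

/-- The last term tends to the jump `gl r`; the remaining ones are κ times those of Q up to η, and
their Q-sum tends to V r - V s - `ql r`. -/
theorem eventually_sumAlong_left (hG : lam.IsAdmissible G gl gr) (hQ : lam.IsAdmissible Q ql qr)
    (hV : ∀ s t, a ≤ s → s < t → t ≤ b → Tendsto (lam.sumAlong Q s t) atTop (𝓝 (V t - V s)))
    {r κ η : ℝ} (hr : r ∈ Ioc a b)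
    (hκ : ∀ᶠ p : ℝ × ℝ in 𝓝[<] r ×ˢ 𝓝[<] r, |G p.1 p.2 - κ * Q p.1 p.2| ≤ η * Q p.1 p.2) :
    ∀ᶠ s in 𝓝[<] r, a ≤ s → ∀ δ > 0, ∀ᶠ m in atTop,
      |lam.sumAlong G s r m - (gl r + κ * (V r - V s - ql r))| ≤
        η * (V r - V s - ql r) + δ := by
  obtain ⟨c, hc, hcG⟩ := exists_Ioo_of_eventually_nhdsLT_prod
    (p := fun u v => |G u v - κ * Q u v| ≤ η * Q u v) hκ
  filter_upwards [Ioo_mem_nhdsLT hc] with s hs has δ hδ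
  choose j hj h1 h2 using lam.exists_left_index hr
  have hu := tendsto_max_left hs.2 (lam.tendsto_left hr hj h1 h2)
  refine eventually_abs_sub_le_of_tendsto (hV s r has hs.2 hr.2) ((hQ.left r hr).comp hu)
    ((hG.left r hr).comp hu) (fun m => ?_) hδ
  have := abs_sumAlong_sub_last_le (G := fun u v => G u v - κ * Q u v)
    (Q := fun u v => η * Q u v) (fun u => by rw [hG.diag, hQ.diag]; ring)
    (fun u => by rw [hQ.diag, mul_zero]) hs.2
    (fun u v hu hur hv hvr => hcG u ⟨hs.1.trans_le hu, hur⟩ v ⟨hs.1.trans_le hv, hvr⟩)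
    (hj m) (h1 m) (h2 m)
  rwa [sumAlong_sub, sumAlong_mul, sumAlong_mul] at this

theorem eventually_sumAlong_right (hG : lam.IsAdmissible G gl gr) (hQ : lam.IsAdmissible Q ql qr)
    (hV : ∀ s t, a ≤ s → s < t → t ≤ b → Tendsto (lam.sumAlong Q s t) atTop (𝓝 (V t - V s)))
    {r κ η : ℝ} (hr : r ∈ Ico a b)
    (hκ : ∀ᶠ p : ℝ × ℝ in 𝓝[>] r ×ˢ 𝓝[>] r, |G p.1 p.2 - κ * Q p.1 p.2| ≤ η * Q p.1 p.2) :
    ∀ᶠ t in 𝓝[>] r, t ≤ b → ∀ δ > 0, ∀ᶠ m in atTop,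
      |lam.sumAlong G r t m - (gr r + κ * (V t - V r - qr r))| ≤
        η * (V t - V r - qr r) + δ := by
  obtain ⟨c, hc, hcG⟩ := exists_Ioo_of_eventually_nhdsGT_prod
    (p := fun u v => |G u v - κ * Q u v| ≤ η * Q u v) hκ
  filter_upwards [Ioo_mem_nhdsGT hc] with t ht htb δ hδ
  choose j hj h1 h2 using lam.exists_right_index hr
  have hu := tendsto_min_right ht.1 (lam.tendsto_right hr hj h1 h2)
  refine eventually_abs_sub_le_of_tendsto (hV r t hr.1 ht.1 htb) ((hQ.right r hr).comp hu)
    ((hG.right r hr).comp hu) (fun m => ?_) hδ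
  have := abs_sumAlong_sub_first_le (G := fun u v => G u v - κ * Q u v)
    (Q := fun u v => η * Q u v) (fun u => by rw [hG.diag, hQ.diag]; ring)
    (fun u => by rw [hQ.diag, mul_zero]) ht.1
    (fun u v hu hur hv hvr => hcG u ⟨hu, hur.trans_lt ht.2⟩ v ⟨hv, hvr.trans_lt ht.2⟩)
    (hj m) (h1 m) (h2 m)
  rwa [sumAlong_sub, sumAlong_mul, sumAlong_mul] at this

theorem tendsto_of_abs_sub_le {l : Filter ℝ} {f q : ℝ → ℝ} {x κ : ℝ} (hq : Tendsto q l (𝓝 0))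
    (h : ∀ᶠ s in l, |f s - (x + κ * q s)| ≤ q s) : Tendsto f l (𝓝 x) := by
  have h1 : Tendsto (fun s => f s - (x + κ * q s)) l (𝓝 0) := squeeze_zero_norm' h hq
  have h2 := h1.add ((hq.const_mul κ).const_add x)
  simpa using h2

/-- If the sums of the nonnegative interval function `Q` converge to the increments of `V` and
`G` is locally comparable to a multiple of `Q`, then the sums of `G` converge as well. -/
theorem exists_tendsto_sumAlong (hG : lam.IsAdmissible G gl gr) (hQ : lam.IsAdmissible Q ql qr)
    (hQ₀ : ∀ u v, 0 ≤ Q u v)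
    (hV : ∀ s t, a ≤ s → s < t → t ≤ b → Tendsto (lam.sumAlong Q s t) atTop (𝓝 (V t - V s)))
    (hVl : ∀ r ∈ Ioc a b, Tendsto V (𝓝[<] r) (𝓝 (V r - ql r)))
    (hVr : ∀ r ∈ Ico a b, Tendsto V (𝓝[>] r) (𝓝 (V r + qr r)))
    (hl : ∀ r ∈ Ioc a b, ∃ κ, ∀ η > 0, ∀ᶠ p : ℝ × ℝ in 𝓝[<] r ×ˢ 𝓝[<] r,
      |G p.1 p.2 - κ * Q p.1 p.2| ≤ η * Q p.1 p.2)
    (hr : ∀ r ∈ Ico a b, ∃ κ, ∀ η > 0, ∀ᶠ p : ℝ × ℝ in 𝓝[>] r ×ˢ 𝓝[>] r,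
      |G p.1 p.2 - κ * Q p.1 p.2| ≤ η * Q p.1 p.2) :
    ∃ Ψ : ℝ → ℝ, Ψ a = 0 ∧
      (∀ s t, a ≤ s → s < t → t ≤ b → Tendsto (lam.sumAlong G s t) atTop (𝓝 (Ψ t - Ψ s))) ∧
      (∀ r ∈ Ioc a b, Tendsto Ψ (𝓝[<] r) (𝓝 (Ψ r - gl r))) ∧
      (∀ r ∈ Ico a b, Tendsto Ψ (𝓝[>] r) (𝓝 (Ψ r + gr r))) := by
  -- The error η (V t - V s) is additive in the interval, so it survives gluing. The arbitrary δ
  -- absorbs the vanishing defect of additivity of the sums.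
  have approx : ∀ η > 0, ∀ s t, a ≤ s → s < t → t ≤ b → ∃ L, ∀ δ > 0, ∀ᶠ m in atTop,
      |lam.sumAlong G s t m - L| ≤ η * (V t - V s) + δ := by
    intro η hη s t hs hst ht
    refine subinterval_induction (P := fun s t => ∃ L, ∀ δ > 0, ∀ᶠ m in atTop,
      |lam.sumAlong G s t m - L| ≤ η * (V t - V s) + δ) ?_ ?_ ?_ hs hst ht
    · rintro s r t hs hsr hrt ht ⟨L₁, h₁⟩ ⟨L₂, h₂⟩
      refine ⟨L₁ + L₂, fun δ hδ => ?_⟩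
      have h3 := (tendsto_zero_iff_abs_tendsto_zero _).1 (hG.tendsto_sumAlong_split hs hsr hrt ht)
      filter_upwards [h₁ (δ / 3) (by positivity), h₂ (δ / 3) (by positivity),
        h3.eventually (gt_mem_nhds (show 0 < δ / 3 by positivity))] with m h1 h2 h3
      simp only [Function.comp_apply] at h3
      rw [abs_le] at h1 h2 ⊢
      rw [abs_lt] at h3
      constructor <;> nlinarith
    · intro r hr'
      obtain ⟨κ, hκ⟩ := hl r hr'
      filter_upwards [eventually_sumAlong_left hG hQ hV hr' (hκ η hη)] with s h hs
      refine ⟨_, fun δ hδ => (h hs δ hδ).mono fun m hm => hm.trans ?_⟩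
      -- Discarding the nonnegative jump from the error makes the bound additive.
      have : 0 ≤ ql r := ge_of_tendsto (hQ.left r hr') (Eventually.of_forall fun u => hQ₀ u r)
      nlinarith
    · intro r hr'
      obtain ⟨κ, hκ⟩ := hr r hr'
      filter_upwards [eventually_sumAlong_right hG hQ hV hr' (hκ η hη)] with s h hs
      refine ⟨_, fun δ hδ => (h hs δ hδ).mono fun m hm => hm.trans ?_⟩
      have : 0 ≤ qr r := ge_of_tendsto (hQ.right r hr') (Eventually.of_forall fun u => hQ₀ r u)
      nlinarith
  have conv : ∀ s t, a ≤ s → s < t → t ≤ b → ∃ L, Tendsto (lam.sumAlong G s t) atTop (𝓝 L) := by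
    intro s t hs hst ht
    refine cauchySeq_tendsto_of_complete (Metric.cauchySeq_iff'.2 fun ε hε => ?_)
    have hv : 0 ≤ V t - V s := ge_of_tendsto (hV s t hs hst ht)
      (Eventually.of_forall fun m => lam.sumAlong_nonneg hst.le m fun u v _ _ _ => hQ₀ u v)
    -- With this η the error is at most ε/8; the added 1 keeps the denominator positive when V t = V
    -- s.
    have hη : 0 < ε / (8 * (V t - V s + 1)) := by positivity
    obtain ⟨L, hL⟩ := approx _ hη s t hs hst ht
    obtain ⟨N, hN⟩ := eventually_atTop.1 (hL (ε / 8) (by positivity))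
    have hle : ε / (8 * (V t - V s + 1)) * (V t - V s) ≤ ε / 8 := by
      rw [div_mul_eq_mul_div, div_le_div_iff₀ (by positivity) (by positivity)]
      nlinarith
    refine ⟨N, fun m hm => ?_⟩
    have h1 := hN m hm
    have h2 := hN N le_rfl
    rw [Real.dist_eq, abs_lt]
    rw [abs_le] at h1 h2
    constructor <;> linarith
  have haa : ∀ m, lam.sumAlong G a a m = 0 := fun m => Finset.sum_eq_zero fun i _ => by
    rw [show lam.trace a a m i = a from max_eq_right (min_le_right _ _),
      show lam.trace a a m (i + 1) = a from max_eq_right (min_le_right _ _), hG.diag]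
  have conv' : ∀ t, ∃ L, t ∈ Icc a b → Tendsto (lam.sumAlong G a t) atTop (𝓝 L) := by
    intro t
    by_cases h : t ∈ Icc a b
    · rcases h.1.eq_or_lt with rfl | h'
      · exact ⟨0, fun _ => tendsto_const_nhds.congr fun m => (haa m).symm⟩
      · obtain ⟨L, hL⟩ := conv a t le_rfl h' h.2
        exact ⟨L, fun _ => hL⟩
    · exact ⟨0, fun h' => absurd h' h⟩
  choose Ψ hΨ using conv'
  have hsum : ∀ s t, a ≤ s → s < t → t ≤ b →
      Tendsto (lam.sumAlong G s t) atTop (𝓝 (Ψ t - Ψ s)) := by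
    intro s t hs hst ht
    have h1 := hΨ t ⟨hs.trans hst.le, ht⟩
    have h2 := hΨ s ⟨hs, hst.le.trans ht⟩
    rcases hs.eq_or_lt with rfl | hs'
    · have : Ψ a = 0 := tendsto_nhds_unique h2 (tendsto_const_nhds.congr fun m => (haa m).symm)
      rwa [this, sub_zero]
    · have := (h1.sub h2).sub (hG.tendsto_sumAlong_split le_rfl hs' hst ht)
      rw [sub_zero] at this
      exact this.congr fun m => by ring
  refine ⟨fun t => Ψ t - Ψ a, sub_self _, fun s t hs hst ht => ?_, fun r hr' => ?_, fun r hr' => ?_⟩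
  · simpa using hsum s t hs hst ht
  · obtain ⟨κ, hκ⟩ := hl r hr'
    have hq : Tendsto (fun s => V r - V s - ql r) (𝓝[<] r) (𝓝 0) := by
      simpa using ((hVl r hr').const_sub (V r)).sub_const (ql r)
    -- The local estimate with η = 1 suffices: its error is the increment of V with the jump
    -- removed, which tends to 0 as s tends to r.
    have : Tendsto (fun s => Ψ r - Ψ s) (𝓝[<] r) (𝓝 (gl r)) := by
      refine tendsto_of_abs_sub_le (κ := κ) hq ?_
      filter_upwards [eventually_sumAlong_left hG hQ hV hr' (hκ 1 one_pos),
        Ioo_mem_nhdsLT hr'.1] with s h hs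
      refine le_of_forall_pos_le_add fun δ hδ => ?_
      have := le_of_tendsto ((hsum s r hs.1.le hs.2 hr'.2).sub_const _).abs (h hs.1.le δ hδ)
      rwa [one_mul] at this
    have := (this.const_sub (Ψ r)).sub_const (Ψ a)
    simp only [sub_sub_cancel] at this
    convert this using 2
    ring
  · obtain ⟨κ, hκ⟩ := hr r hr'
    have hq : Tendsto (fun t => V t - V r - qr r) (𝓝[>] r) (𝓝 0) := by
      simpa using ((hVr r hr').sub_const (V r)).sub_const (qr r)
    have : Tendsto (fun t => Ψ t - Ψ r) (𝓝[>] r) (𝓝 (gr r)) := by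
      refine tendsto_of_abs_sub_le (κ := κ) hq ?_
      filter_upwards [eventually_sumAlong_right hG hQ hV hr' (hκ 1 one_pos),
        Ioo_mem_nhdsGT hr'.2] with t h ht
      refine le_of_forall_pos_le_add fun δ hδ => ?_
      have := le_of_tendsto ((hsum r t hr'.1 ht.1 ht.2.le).sub_const _).abs (h ht.2.le δ hδ)
      rwa [one_mul] at this
    have := (this.add_const (Ψ r)).sub_const (Ψ a)
    simp only [sub_add_cancel] at this
    convert this using 2
    ring

end PartitionSeq

/-! ### Logarithm estimates -/

theorem eventually_abs_sub_log_one_add_sub_le {η : ℝ} (hη : 0 < η) :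
    ∀ᶠ x : ℝ in 𝓝 0, |x - Real.log (1 + x) - 1 / 2 * x ^ 2| ≤ η * x ^ 2 := by
  -- The bound 1/2 turns the remainder |x|³/(1 - |x|) into at most 2|x|³, and η/2 turns that into at
  -- most η x².
  have hd : 0 < min (1 / 2) (η / 2) := by positivity
  filter_upwards [Metric.ball_mem_nhds (0 : ℝ) hd] with x hx
  rw [mem_ball_zero_iff, Real.norm_eq_abs, lt_min_iff] at hx
  have h := Real.abs_log_sub_add_sum_range_le (x := -x) (by rw [abs_neg]; linarith) 2
  simp only [Finset.sum_range_succ, Finset.sum_range_zero, abs_neg, sub_neg_eq_add] at h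
  norm_num at h
  calc |x - Real.log (1 + x) - 1 / 2 * x ^ 2|
      = |-x + x ^ 2 / 2 + Real.log (1 + x)| := by rw [← abs_neg]; congr 1; ring
    _ ≤ |x| ^ 3 / (1 - |x|) := h
    _ ≤ η * x ^ 2 := by
        rw [div_le_iff₀ (by linarith), ← sq_abs x]
        nlinarith [sq_nonneg |x|, abs_nonneg x, mul_nonneg (sq_nonneg |x|) (abs_nonneg x),
          mul_nonneg (sq_nonneg |x|) (by linarith [hx.2] : 0 ≤ η / 2 - |x|),
          mul_nonneg (sq_nonneg |x|) (by linarith [hx.1] : 0 ≤ 1 / 2 - |x|)]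

theorem abs_log_one_add_sub_le {x : ℝ} (hx : |x| ≤ 1 / 2) :
    |Real.log (1 + x) - x| ≤ 2 * x ^ 2 := by
  obtain ⟨h1, h2⟩ := abs_le.1 hx
  have hpos : 0 < 1 + x := by linarith
  have hu := Real.log_le_sub_one_of_pos hpos
  have hl := Real.one_sub_inv_le_log_of_pos hpos
  have h3 : 1 - (1 + x)⁻¹ - x = -(x ^ 2 / (1 + x)) := by field_simp; ring
  have h4 : x ^ 2 / (1 + x) ≤ 2 * x ^ 2 := by
    rw [div_le_iff₀ hpos]
    nlinarith [mul_nonneg (sq_nonneg x) (by linarith : 0 ≤ 1 + 2 * x)]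
  rw [abs_le]
  constructor <;> nlinarith [sq_nonneg x]

/-! ### Regulated functions -/

variable {a b : ℝ}

theorem IsRegulated.tendsto_leftLim {f : ℝ → ℝ} (hf : IsRegulated a b f) {t : ℝ}
    (ht : t ∈ Ioc a b) : Tendsto f (𝓝[<] t) (𝓝 (Function.leftLim f t)) := by
  obtain ⟨l, hl⟩ := hf.1 t ht
  rwa [leftLim_eq_of_tendsto hl]

theorem IsRegulated.tendsto_rightLim {f : ℝ → ℝ} (hf : IsRegulated a b f) {t : ℝ}
    (ht : t ∈ Ico a b) : Tendsto f (𝓝[>] t) (𝓝 (Function.rightLim f t)) := by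
  obtain ⟨l, hl⟩ := hf.2 t ht
  rwa [rightLim_eq_of_tendsto hl]

theorem IsRegulated.exists_forall_le {f : ℝ → ℝ} (hf : IsRegulated a b f) (hab : a < b) :
    ∃ M, ∀ x ∈ Icc a b, f x ≤ M := by
  refine subinterval_induction (P := fun s t => ∃ M, ∀ x ∈ Icc s t, f x ≤ M) ?_ ?_ ?_
    le_rfl hab le_rfl
  · rintro s r t - - - - ⟨M, hM⟩ ⟨N, hN⟩
    refine ⟨max M N, fun x hx => ?_⟩
    rcases le_total x r with h | h
    · exact (hM x ⟨hx.1, h⟩).trans (le_max_left _ _)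
    · exact (hN x ⟨h, hx.2⟩).trans (le_max_right _ _)
  · intro r hr
    obtain ⟨c, hc, hcf⟩ := mem_nhdsLT_iff_exists_Ioo_subset.1
      ((hf.tendsto_leftLim hr).eventually (gt_mem_nhds (lt_add_one _)))
    filter_upwards [Ioo_mem_nhdsLT hc] with s hs _
    refine ⟨max (f r) (Function.leftLim f r + 1), fun x hx => ?_⟩
    rcases hx.2.eq_or_lt with h | h
    · exact h ▸ le_max_left _ _
    · exact (hcf ⟨hs.1.trans_le hx.1, h⟩).le.trans (le_max_right _ _)
  · intro r hr
    obtain ⟨c, hc, hcf⟩ := mem_nhdsGT_iff_exists_Ioo_subset.1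
      ((hf.tendsto_rightLim hr).eventually (gt_mem_nhds (lt_add_one _)))
    filter_upwards [Ioo_mem_nhdsGT hc] with s hs _
    refine ⟨max (f r) (Function.rightLim f r + 1), fun x hx => ?_⟩
    rcases hx.1.eq_or_lt with h | h
    · exact h ▸ le_max_left _ _
    · exact (hcf ⟨h, hx.2.trans_lt hs.2⟩).le.trans (le_max_right _ _)

/-! ### Relative increments of a function in `classL`, their bracket and their sums -/

namespace PartitionSeq

variable {lam : PartitionSeq a b} {f g : ℝ → ℝ}

theorem classL_left (hf : f ∈ classL lam) : ∀ r ∈ Ioc a b,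
    Tendsto f (𝓝[<] r) (𝓝 (Function.leftLim f r)) ∧ 0 < Function.leftLim f r := by
  intro r hr
  have h := hf.1.1.tendsto_leftLim hr
  obtain ⟨C, hC, hCf⟩ := hf.2.2.1
  refine ⟨h, hC.trans_le (ge_of_tendsto h ?_)⟩
  filter_upwards [Ioo_mem_nhdsLT hr.1] with x hx using hCf x ⟨hx.1.le, hx.2.le.trans hr.2⟩

theorem classL_right (hf : f ∈ classL lam) : ∀ r ∈ Ico a b,
    Tendsto f (𝓝[>] r) (𝓝 (Function.rightLim f r)) ∧ 0 < Function.rightLim f r := by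
  intro r hr
  have h := hf.1.1.tendsto_rightLim hr
  obtain ⟨C, hC, hCf⟩ := hf.2.2.1
  refine ⟨h, hC.trans_le (ge_of_tendsto h ?_)⟩
  filter_upwards [Ioo_mem_nhdsGT hr.2] with x hx using hCf x ⟨hr.1.trans hx.1.le, hx.2.le⟩

theorem classL_accessible (hf : f ∈ classL lam) : ∀ r ∈ Ioo a b, r ∉ lam.points →
    Function.rightLim f r = f r := by
  intro r hr hn
  by_contra h
  refine hn (hf.2.2.2 ⟨hr, ?_⟩)
  rw [jumpRight, if_pos hr.2]
  exact sub_ne_zero.2 h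

theorem classL_pos (hf : f ∈ classL lam) : ∀ r ∈ Icc a b, 0 < f r := by
  obtain ⟨C, hC, hCf⟩ := hf.2.2.1
  exact fun r hr => hC.trans_le (hCf r hr)

/-- The relative increment `(f v - f u) / f u`. -/
noncomputable def relIncr (f : ℝ → ℝ) (u v : ℝ) : ℝ := (f v - f u) / f u

theorem classL_admissible (hf : f ∈ classL lam) {F : ℝ → ℝ → ℝ} (hF₀ : ∀ x, F x x = 0)
    (hF : ∀ x y, 0 < x → 0 < y → ContinuousAt (fun p : ℝ × ℝ => F p.1 p.2) (x, y)) :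
    lam.IsAdmissible (fun u v => F (f u) (f v)) (fun r => F (Function.leftLim f r) (f r))
      (fun r => F (f r) (Function.rightLim f r)) :=
  isAdmissible_comp (classL_left hf) (classL_right hf) (classL_accessible hf) (classL_pos hf)
    hF₀ hF

theorem admissible_relIncr (hf : f ∈ classL lam) : lam.IsAdmissible (relIncr f)
    (fun r => (f r - Function.leftLim f r) / Function.leftLim f r)
    (fun r => (Function.rightLim f r - f r) / f r) :=
  classL_admissible hf (F := fun x y => (y - x) / x) (fun x => by simp) fun x y hx _ =>
    (continuousAt_snd.sub continuousAt_fst).div continuousAt_fst hx.ne'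

theorem admissible_relIncr_sq (hf : f ∈ classL lam) :
    lam.IsAdmissible (fun u v => relIncr f u v ^ 2)
    (fun r => ((f r - Function.leftLim f r) / Function.leftLim f r) ^ 2)
    (fun r => ((Function.rightLim f r - f r) / f r) ^ 2) :=
  classL_admissible hf (F := fun x y => ((y - x) / x) ^ 2) (fun x => by simp) fun x y hx _ =>
    ((continuousAt_snd.sub continuousAt_fst).div continuousAt_fst hx.ne').pow 2

theorem admissible_relIncr_sub_log (hf : f ∈ classL lam) :
    lam.IsAdmissible (fun u v => relIncr f u v - (Real.log (f v) - Real.log (f u)))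
    (fun r => (f r - Function.leftLim f r) / Function.leftLim f r -
      (Real.log (f r) - Real.log (Function.leftLim f r)))
    (fun r => (Function.rightLim f r - f r) / f r -
      (Real.log (Function.rightLim f r) - Real.log (f r))) :=
  classL_admissible hf (F := fun x y => (y - x) / x - (Real.log y - Real.log x))
    (fun x => by simp) fun x y hx hy =>
    ((continuousAt_snd.sub continuousAt_fst).div continuousAt_fst hx.ne').sub
      ((continuousAt_snd.log hy.ne').sub (continuousAt_fst.log hx.ne'))

theorem log_sub_log_eq {x y : ℝ} (hx : 0 < x) (hy : 0 < y) :
    Real.log y - Real.log x = Real.log (1 + (y - x) / x) := by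
  rw [← Real.log_div hy.ne' hx.ne']
  congr 1
  field_simp
  ring

/-- W plays the role of the integral of f⁻² against the bracket of f: near r the factor f(u)⁻² is
almost constant, and its one-sided limit is the comparison constant κ. -/
theorem exists_relIncr_bracket (hf : f ∈ classL lam) :
    ∃ W : ℝ → ℝ, W a = 0 ∧
      (∀ s t, a ≤ s → s < t → t ≤ b →
        Tendsto (lam.sumAlong (fun u v => relIncr f u v ^ 2) s t) atTop (𝓝 (W t - W s))) ∧
      (∀ r ∈ Ioc a b, Tendsto W (𝓝[<] r)
        (𝓝 (W r - ((f r - Function.leftLim f r) / Function.leftLim f r) ^ 2))) ∧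
      (∀ r ∈ Ico a b, Tendsto W (𝓝[>] r)
        (𝓝 (W r + ((Function.rightLim f r - f r) / f r) ^ 2))) := by
  obtain ⟨V, hVreg, hV0, hV⟩ := hf.1.2
  refine exists_tendsto_sumAlong (V := V) (admissible_relIncr_sq hf)
    (classL_admissible hf (F := fun x y => (y - x) ^ 2) (fun x => by simp)
      fun x y _ _ => (continuousAt_snd.sub continuousAt_fst).pow 2)
    (fun u v => sq_nonneg _) (fun s t hs hst ht => (hV s t hs hst ht).1) ?_ ?_ ?_ ?_
  · intro r hr
    have h1 := hVreg.tendsto_leftLim hr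
    have h2 := (hV a r le_rfl hr.1 hr.2).2.1
    rw [jumpLeft, jumpLeft, if_pos hr.1, if_pos hr.1] at h2
    rwa [← h2, sub_sub_cancel]
  · intro r hr
    have h1 := hVreg.tendsto_rightLim hr
    have h2 := (hV r b hr.1 hr.2 le_rfl).2.2
    rw [jumpRight, jumpRight, if_pos hr.2, if_pos hr.2] at h2
    rwa [← h2, add_sub_cancel]
  · intro r hr
    obtain ⟨h, hpos⟩ := classL_left hf r hr
    refine ⟨(Function.leftLim f r ^ 2)⁻¹, fun η hη => ?_⟩
    have h1 : Tendsto (fun u => |(f u ^ 2)⁻¹ - (Function.leftLim f r ^ 2)⁻¹|) (𝓝[<] r) (𝓝 0) := by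
      have := (((h.pow 2).inv₀ (by positivity)).sub_const (Function.leftLim f r ^ 2)⁻¹).abs
      rwa [sub_self, abs_zero] at this
    filter_upwards [tendsto_fst.eventually (h1.eventually (gt_mem_nhds hη))] with p hp
    rw [relIncr, div_pow, div_eq_inv_mul, ← sub_mul, abs_mul, abs_of_nonneg (sq_nonneg (f p.2 - _))]
    exact mul_le_mul_of_nonneg_right hp.le (sq_nonneg _)
  · intro r hr
    obtain ⟨h, hpos⟩ := classL_right hf r hr
    refine ⟨(Function.rightLim f r ^ 2)⁻¹, fun η hη => ?_⟩
    have h1 : Tendsto (fun u => |(f u ^ 2)⁻¹ - (Function.rightLim f r ^ 2)⁻¹|) (𝓝[>] r)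
        (𝓝 0) := by
      have := (((h.pow 2).inv₀ (by positivity)).sub_const (Function.rightLim f r ^ 2)⁻¹).abs
      rwa [sub_self, abs_zero] at this
    filter_upwards [tendsto_fst.eventually (h1.eventually (gt_mem_nhds hη))] with p hp
    rw [relIncr, div_pow, div_eq_inv_mul, ← sub_mul, abs_mul, abs_of_nonneg (sq_nonneg (f p.2 - _))]
    exact mul_le_mul_of_nonneg_right hp.le (sq_nonneg _)

theorem relIncr_sub_log_nonneg (hf : f ∈ classL lam) {u v : ℝ} (hu : u ∈ Icc a b)
    (hv : v ∈ Icc a b) : 0 ≤ relIncr f u v - (Real.log (f v) - Real.log (f u)) := by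
  have hu' := classL_pos hf u hu
  have hv' := classL_pos hf v hv
  rw [← Real.log_div hv'.ne' hu'.ne', relIncr, sub_div, div_self hu'.ne']
  have := Real.log_le_sub_one_of_pos (div_pos hv' hu')
  linarith

/-- Existence of the indefinite Left Cauchy integral `Φ` of `1 / f` with respect to `f`. -/
theorem exists_relIncr_primitive (hf : f ∈ classL lam) :
    ∃ Φ : ℝ → ℝ, Φ a = 0 ∧
      (∀ s t, a ≤ s → s < t → t ≤ b →
        Tendsto (lam.sumAlong (relIncr f) s t) atTop (𝓝 (Φ t - Φ s))) ∧
      (∀ r ∈ Ioc a b, Tendsto Φ (𝓝[<] r)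
        (𝓝 (Φ r - (f r - Function.leftLim f r) / Function.leftLim f r))) ∧
      (∀ r ∈ Ico a b, Tendsto Φ (𝓝[>] r)
        (𝓝 (Φ r + (Function.rightLim f r - f r) / f r))) ∧
      MonotoneOn (fun t => Φ t - Real.log (f t)) (Icc a b) := by
  obtain ⟨W, -, hW, hWl, hWr⟩ := exists_relIncr_bracket hf
  have near : ∀ {l : Filter (ℝ × ℝ)}, Tendsto (fun p : ℝ × ℝ => relIncr f p.1 p.2) l (𝓝 0) →
      (∀ᶠ p in l, 0 < f p.1 ∧ 0 < f p.2) → ∀ η > 0, ∀ᶠ p : ℝ × ℝ in l,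
      |relIncr f p.1 p.2 - (Real.log (f p.2) - Real.log (f p.1)) - 1 / 2 * relIncr f p.1 p.2 ^ 2|
        ≤ η * relIncr f p.1 p.2 ^ 2 := by
    intro l hl hpos η hη
    filter_upwards [hl.eventually (eventually_abs_sub_log_one_add_sub_le hη), hpos] with p hp h
    rwa [log_sub_log_eq h.1 h.2]
  -- Subtracting the telescoping increment of log f removes the first order term, which Q could not
  -- dominate; the second order Taylor term leaves κ = 1/2.
  obtain ⟨Ψ, hΨ0, hΨ, hΨl, hΨr⟩ := exists_tendsto_sumAlong (admissible_relIncr_sub_log hf)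
    (admissible_relIncr_sq hf) (fun u v => sq_nonneg _) hW hWl hWr
    (fun r hr => ⟨1 / 2, near ((admissible_relIncr hf).near_left r hr) (by
      obtain ⟨h, hp⟩ := classL_left hf r hr
      have := h.eventually (lt_mem_nhds hp)
      exact (tendsto_fst.eventually this).and (tendsto_snd.eventually this))⟩)
    (fun r hr => ⟨1 / 2, near ((admissible_relIncr hf).near_right r hr) (by
      obtain ⟨h, hp⟩ := classL_right hf r hr
      have := h.eventually (lt_mem_nhds hp)
      exact (tendsto_fst.eventually this).and (tendsto_snd.eventually this))⟩)
  refine ⟨fun t => Ψ t + Real.log (f t), ?_, fun s t hs hst ht => ?_, fun r hr => ?_,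
    fun r hr => ?_, ?_⟩
  · simp [hΨ0, hf.2.1]
  · have h1 := (hΨ s t hs hst ht).add_const (Real.log (f t) - Real.log (f s))
    have h2 : Ψ t - Ψ s + (Real.log (f t) - Real.log (f s)) =
        Ψ t + Real.log (f t) - (Ψ s + Real.log (f s)) := by ring
    rw [h2] at h1
    refine h1.congr fun m => ?_
    rw [← lam.sumAlong_increment (fun x => Real.log (f x)) hs hst.le ht m, ← sumAlong_add]
    simp
  · obtain ⟨h, hp⟩ := classL_left hf r hr
    convert (hΨl r hr).add (h.log hp.ne') using 2
    ring
  · obtain ⟨h, hp⟩ := classL_right hf r hr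
    convert (hΨr r hr).add (h.log hp.ne') using 2
    ring
  -- Here Φ - log f is Ψ, a limit of sums of nonnegative terms.
  · intro s hs t ht hst
    simp only [add_sub_cancel_right]
    rcases hst.eq_or_lt with rfl | hst'
    · exact le_rfl
    · refine sub_nonneg.1 (ge_of_tendsto (hΨ s t hs.1 hst' ht.2) (Eventually.of_forall fun m => ?_))
      exact lam.sumAlong_nonneg hst m fun u v hu huv hv => relIncr_sub_log_nonneg hf
        ⟨hs.1.trans hu, (huv.trans hv).trans ht.2⟩ ⟨(hs.1.trans hu).trans huv, hv.trans ht.2⟩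

end PartitionSeq

/-! ### The defect of a candidate logarithm and the limit of its products -/

namespace PartitionSeq

variable {a b : ℝ} {lam : PartitionSeq a b} {f g : ℝ → ℝ}

/-- `g` has the same jumps as an indefinite Left Cauchy integral of `1 / f` with respect to
`f`. -/
structure HasLogJumps (a b : ℝ) (f g : ℝ → ℝ) : Prop where
  left : ∀ r ∈ Ioc a b, Tendsto g (𝓝[<] r)
    (𝓝 (g r - (f r - Function.leftLim f r) / Function.leftLim f r))
  right : ∀ r ∈ Ico a b, Tendsto g (𝓝[>] r)
    (𝓝 (g r + (Function.rightLim f r - f r) / f r))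

theorem HasLogJumps.isRegulated (hg : HasLogJumps a b f g) : IsRegulated a b g :=
  ⟨fun r hr => ⟨_, hg.left r hr⟩, fun r hr => ⟨_, hg.right r hr⟩⟩

theorem HasLogJumps.jumpLeft_eq (hg : HasLogJumps a b f g) {t : ℝ} (ht : t ∈ Ioc a b) :
    jumpLeft a g t = (f t - Function.leftLim f t) / Function.leftLim f t := by
  rw [jumpLeft, if_pos ht.1, leftLim_eq_of_tendsto (hg.left t ht), sub_sub_cancel]

theorem HasLogJumps.jumpRight_eq (hg : HasLogJumps a b f g) {t : ℝ} (ht : t ∈ Ico a b) :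
    jumpRight b g t = (Function.rightLim f t - f t) / f t := by
  rw [jumpRight, if_pos ht.2, rightLim_eq_of_tendsto (hg.right t ht), add_sub_cancel_left]

theorem HasLogJumps.admissible_increment (hf : f ∈ classL lam) (hg : HasLogJumps a b f g) :
    lam.IsAdmissible (fun u v => g v - g u)
      (fun r => (f r - Function.leftLim f r) / Function.leftLim f r)
      (fun r => (Function.rightLim f r - f r) / f r) :=
  (isAdmissible_increment hg.left hg.right fun r hr hn => by
    rw [classL_accessible hf r hr hn, sub_self, zero_div, add_zero]).congr
    (fun _ _ => by ring) (fun _ _ => by ring)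

theorem HasLogJumps.admissible_defect (hf : f ∈ classL lam) (hg : HasLogJumps a b f g) :
    lam.IsAdmissible (fun u v => g v - g u - relIncr f u v) (fun _ => 0) (fun _ => 0) :=
  ((hg.admissible_increment hf).sub (admissible_relIncr hf)).congr
    (fun _ _ => sub_self _) (fun _ _ => sub_self _)

/-- The defect is a difference of two nonnegative quantities, the increment of g - log f and
`relIncr` minus the increment of log f. Hence |d| is at most their sum, whose totals B m converge,
while uniform smallness gives d² ≤ ε |d|. -/
theorem tendsto_sumAlong_defect_sq (hf : f ∈ classL lam) (hg : HasLogJumps a b f g)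
    (hmono : MonotoneOn (fun t => g t - Real.log (f t)) (Icc a b)) {s t : ℝ} (hs : a ≤ s)
    (hst : s < t) (ht : t ≤ b) :
    Tendsto (lam.sumAlong (fun u v => (g v - g u - relIncr f u v) ^ 2) s t) atTop (𝓝 0) := by
  obtain ⟨Φ, -, hΦ, -⟩ := exists_relIncr_primitive hf
  set B : ℕ → ℝ := fun m => (g t - g s - (Real.log (f t) - Real.log (f s))) +
    (lam.sumAlong (relIncr f) s t m - (Real.log (f t) - Real.log (f s))) with hB
  have hBlim : Tendsto B atTop (𝓝 ((g t - g s - (Real.log (f t) - Real.log (f s))) +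
      (Φ t - Φ s - (Real.log (f t) - Real.log (f s))))) :=
    ((hΦ s t hs hst ht).sub_const _).const_add _
  set β := (g t - g s - (Real.log (f t) - Real.log (f s))) +
      (Φ t - Φ s - (Real.log (f t) - Real.log (f s)))
  have key : ∀ ε > 0, ∀ᶠ m in atTop,
      lam.sumAlong (fun u v => (g v - g u - relIncr f u v) ^ 2) s t m ≤ ε * B m := by
    intro ε hε
    filter_upwards [(hg.admissible_defect hf).eventually_abs_le hε hs hst ht] with m hm
    have hBm : B m = lam.sumAlong (fun u v => (g v - g u - (Real.log (f v) - Real.log (f u))) +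
        (relIncr f u v - (Real.log (f v) - Real.log (f u)))) s t m := by
      rw [sumAlong_add, lam.sumAlong_sub (fun u v => g v - g u), lam.sumAlong_sub (relIncr f),
        lam.sumAlong_increment (fun x => Real.log (f x)) hs hst.le ht m,
        lam.sumAlong_increment g hs hst.le ht m]
    rw [hBm, sumAlong, sumAlong, Finset.mul_sum]
    refine Finset.sum_le_sum fun i hi => ?_
    have h1 := hm i (Finset.mem_range.1 hi)
    have hx := lam.trace_mem_Icc hst.le m i
    have hy := lam.trace_mem_Icc hst.le m (i + 1)
    have hxy := lam.trace_mono (s := s) (t := t) (Nat.le_succ i) (Finset.mem_range.1 hi)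
    generalize lam.trace s t m i = x at *
    generalize lam.trace s t m (i + 1) = y at *
    have hx' : x ∈ Icc a b := ⟨hs.trans hx.1, hx.2.trans ht⟩
    have hy' : y ∈ Icc a b := ⟨hs.trans hy.1, hy.2.trans ht⟩
    have p1 := relIncr_sub_log_nonneg hf hx' hy'
    have p2 := hmono hx' hy' hxy
    simp only at p2
    have h2 : |g y - g x - relIncr f x y| ≤ (g y - g x - (Real.log (f y) - Real.log (f x))) +
        (relIncr f x y - (Real.log (f y) - Real.log (f x))) := by
      rw [abs_le]; constructor <;> linarith
    rw [← sq_abs, sq]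
    exact mul_le_mul h1 h2 (abs_nonneg _) hε.le
  have hnn : ∀ m, 0 ≤ lam.sumAlong (fun u v => (g v - g u - relIncr f u v) ^ 2) s t m :=
    fun m => lam.sumAlong_nonneg hst.le m fun u v _ _ _ => sq_nonneg _
  refine tendsto_order.2 ⟨fun c hc => Eventually.of_forall fun m => hc.trans_le (hnn m),
    fun c hc => ?_⟩
  have hpos : 0 < |β| + 1 := by positivity
  have hε : 0 < c / (|β| + 1) := by positivity
  filter_upwards [key _ hε, hBlim.eventually
    (gt_mem_nhds ((le_abs_self β).trans_lt (lt_add_one _)))] with m h1 h2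
  refine h1.trans_lt ?_
  calc c / (|β| + 1) * B m < c / (|β| + 1) * (|β| + 1) := by gcongr
    _ = c := by field_simp

/-- A lower bound over an upper bound of f. It keeps the factors 1 + dg positive once the defect is
small, and it bounds 1 plus the jumps of the λ-logarithm below. -/
theorem exists_le_div (hf : f ∈ classL lam) (hab : a < b) :
    ∃ c > 0, c ≤ 1 ∧ (∀ u ∈ Icc a b, ∀ v ∈ Icc a b, c ≤ f v / f u) ∧
      (∀ r ∈ Ioc a b, c ≤ f r / Function.leftLim f r) ∧
      (∀ r ∈ Ico a b, c ≤ Function.rightLim f r / f r) := by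
  obtain ⟨C, hC, hCf⟩ := hf.2.2.1
  obtain ⟨M, hM⟩ := hf.1.1.exists_forall_le hab
  have hMpos : 0 < M := hC.trans_le ((hCf a ⟨le_rfl, hab.le⟩).trans (hM a ⟨le_rfl, hab.le⟩))
  have h : ∀ u ∈ Icc a b, ∀ v ∈ Icc a b, C / M ≤ f v / f u := fun u hu v hv =>
    div_le_div₀ (classL_pos hf v hv).le (hCf v hv) (classL_pos hf u hu) (hM u hu)
  refine ⟨C / M, div_pos hC hMpos, ?_, h, fun r hr => ?_, fun r hr => ?_⟩
  · rw [div_le_one hMpos]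
    exact (hCf a ⟨le_rfl, hab.le⟩).trans (hM a ⟨le_rfl, hab.le⟩)
  · obtain ⟨h1, h2⟩ := classL_left hf r hr
    refine ge_of_tendsto ((tendsto_const_nhds (x := f r)).div h1 h2.ne') ?_
    filter_upwards [Ioo_mem_nhdsLT hr.1] with x hx
    exact h x ⟨hx.1.le, hx.2.le.trans hr.2⟩ r ⟨hr.1.le, hr.2⟩
  · have hr' : r ∈ Icc a b := ⟨hr.1, hr.2.le⟩
    refine ge_of_tendsto ((classL_right hf r hr).1.div_const (f r)) ?_
    filter_upwards [Ioo_mem_nhdsGT hr.2] with x hx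
    exact h r hr' x ⟨hr.1.trans hx.1.le, hx.2.le⟩

theorem one_add_relIncr (hf : f ∈ classL lam) {u : ℝ} (hu : u ∈ Icc a b) (v : ℝ) :
    1 + relIncr f u v = f v / f u := by
  have := classL_pos hf u hu
  rw [relIncr]
  field_simp
  ring

/-- Write the difference as log(1 + d/r) - d/r plus d/r - d: the first is quadratic in d, the second
equals -d(r - 1)/r. With r = f v/f u the factor r - 1 is the relative increment. -/
theorem abs_log_add_sub_log_sub_le {c r d : ℝ} (hc : 0 < c) (hr : c ≤ r) (hd : |d| ≤ c / 2) :
    |Real.log (r + d) - Real.log r - d| ≤ 2 / c ^ 2 * d ^ 2 + 1 / c * (|d| * |r - 1|) := by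
  have hr0 : 0 < r := hc.trans_le hr
  have hrd : 0 < r + d := by linarith [(abs_le.1 hd).1]
  have hx : |d / r| ≤ 1 / 2 := by
    rw [abs_div, abs_of_pos hr0, div_le_iff₀ hr0]
    linarith
  have h1 := abs_log_one_add_sub_le hx
  have h2 : Real.log (r + d) - Real.log r = Real.log (1 + d / r) := by
    rw [← Real.log_div hrd.ne' hr0.ne', add_div, div_self hr0.ne']
  have h3 : (d / r) ^ 2 ≤ d ^ 2 / c ^ 2 := by
    rw [div_pow]
    gcongr
  have h4 : |d / r - d| ≤ 1 / c * (|d| * |r - 1|) := by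
    have : d / r - d = -(1 / r * (d * (r - 1))) := by field_simp; ring
    rw [this, abs_neg, abs_mul, abs_mul, abs_of_pos (one_div_pos.2 hr0)]
    gcongr
  calc |Real.log (r + d) - Real.log r - d|
      = |(Real.log (1 + d / r) - d / r) + (d / r - d)| := by rw [h2]; congr 1; ring
    _ ≤ 2 * (d ^ 2 / c ^ 2) + 1 / c * (|d| * |r - 1|) :=
      (abs_add_le _ _).trans (add_le_add (h1.trans (by linarith)) h4)
    _ = _ := by ring

theorem eventually_increment_close (hf : f ∈ classL lam) (hg : HasLogJumps a b f g) {s t c : ℝ}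
    (hc : 0 < c) (hs : a ≤ s) (hst : s < t) (ht : t ≤ b) :
    ∀ᶠ m in atTop, ∀ i < lam.n m,
      |(1 + g (lam.trace s t m (i + 1)) - g (lam.trace s t m i)) -
        f (lam.trace s t m (i + 1)) / f (lam.trace s t m i)| ≤ c := by
  filter_upwards [(hg.admissible_defect hf).eventually_abs_le hc hs hst ht] with m hm i hi
  have hx := lam.trace_mem_Icc hst.le m i
  rw [← one_add_relIncr hf ⟨hs.trans hx.1, hx.2.trans ht⟩]
  convert hm i hi using 2
  ring

/-- The products of `1 + dg` along `λ`. -/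
theorem tendsto_prod_one_add (hf : f ∈ classL lam) (hg : HasLogJumps a b f g)
    (hmono : MonotoneOn (fun t => g t - Real.log (f t)) (Icc a b)) {s t ℓ : ℝ} (hs : a ≤ s)
    (hst : s < t) (ht : t ≤ b) (hℓ : Tendsto (lam.sumAlong (relIncr f) s t) atTop (𝓝 ℓ)) :
    Tendsto (fun m => ∏ i ∈ Finset.range (lam.n m),
      (1 + g (lam.trace s t m (i + 1)) - g (lam.trace s t m i))) atTop
      (𝓝 (f t / f s * Real.exp (g t - g s - ℓ))) := by
  obtain ⟨c, hc, -, hcf, -⟩ := exists_le_div hf (hs.trans_lt (hst.trans_le ht))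
  obtain ⟨W, -, hW, -⟩ := exists_relIncr_bracket hf
  have hd2 := tendsto_sumAlong_defect_sq hf hg hmono hs hst ht
  -- The summed pointwise error, its mixed term bounded by Cauchy–Schwarz: Σ d² → 0 while the sums
  -- of squared relative increments converge.
  have herr : Tendsto (fun m =>
      2 / c ^ 2 * lam.sumAlong (fun u v => (g v - g u - relIncr f u v) ^ 2) s t m +
      1 / c * (√(lam.sumAlong (fun u v => (g v - g u - relIncr f u v) ^ 2) s t m) *
        √(lam.sumAlong (fun u v => relIncr f u v ^ 2) s t m))) atTop (𝓝 0) := by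
    simpa using (hd2.const_mul (2 / c ^ 2)).add
      ((hd2.sqrt.mul (hW s t hs hst ht).sqrt).const_mul (1 / c))
  have hclose := eventually_increment_close hf hg (half_pos hc) hs hst ht
  have hmem : ∀ m i, lam.trace s t m i ∈ Icc a b := fun m i =>
    have h := lam.trace_mem_Icc hst.le m i
    ⟨hs.trans h.1, h.2.trans ht⟩
  have hlog : Tendsto (fun m => ∑ i ∈ Finset.range (lam.n m),
      Real.log (1 + g (lam.trace s t m (i + 1)) - g (lam.trace s t m i)) -
        (Real.log (f t) - Real.log (f s)) - (g t - g s - lam.sumAlong (relIncr f) s t m))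
      atTop (𝓝 0) := by
    refine squeeze_zero_norm' ?_ herr
    filter_upwards [hclose] with m hm
    rw [← lam.sumAlong_increment g hs hst.le ht m, ← sumAlong_sub,
      ← lam.sumAlong_increment (fun x => Real.log (f x)) hs hst.le ht m]
    have hcs := Real.sum_mul_le_sqrt_mul_sqrt (Finset.range (lam.n m))
      (fun i => |g (lam.trace s t m (i + 1)) - g (lam.trace s t m i) -
        relIncr f (lam.trace s t m i) (lam.trace s t m (i + 1))|)
      (fun i => |relIncr f (lam.trace s t m i) (lam.trace s t m (i + 1))|)
    simp only [sq_abs] at hcs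
    unfold sumAlong
    refine le_trans ?_ (add_le_add_right (mul_le_mul_of_nonneg_left hcs (by positivity)) _)
    rw [← Finset.sum_sub_distrib, ← Finset.sum_sub_distrib, Finset.mul_sum, Finset.mul_sum,
      ← Finset.sum_add_distrib, Real.norm_eq_abs]
    refine (Finset.abs_sum_le_sum_abs _ _).trans (Finset.sum_le_sum fun i hi => ?_)
    have hx := hmem m i
    have hy := hmem m (i + 1)
    have h1 := hm i (Finset.mem_range.1 hi)
    generalize lam.trace s t m i = x at *
    generalize lam.trace s t m (i + 1) = y at *
    rw [← one_add_relIncr hf hx] at h1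
    have h2 : c ≤ 1 + relIncr f x y := one_add_relIncr hf hx y ▸ hcf x hx y hy
    have h3 := abs_log_add_sub_log_sub_le (d := g y - g x - relIncr f x y) hc h2 (by
      convert h1 using 2; ring)
    rw [show 1 + relIncr f x y + (g y - g x - relIncr f x y) = 1 + g y - g x by ring,
      add_sub_cancel_left] at h3
    beta_reduce
    rwa [log_sub_log_eq (classL_pos hf x hx) (classL_pos hf y hy)]
  have hsum : Tendsto (fun m => ∑ i ∈ Finset.range (lam.n m),
      Real.log (1 + g (lam.trace s t m (i + 1)) - g (lam.trace s t m i))) atTop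
      (𝓝 (Real.log (f t / f s) + (g t - g s - ℓ))) := by
    have hs' := classL_pos hf s ⟨hs, hst.le.trans ht⟩
    have ht' := classL_pos hf t ⟨hs.trans hst.le, ht⟩
    have := (hlog.add (hℓ.const_sub (g t - g s))).const_add (Real.log (f t) - Real.log (f s))
    rw [zero_add, ← Real.log_div ht'.ne' hs'.ne'] at this
    exact this.congr fun m => by ring
  have hexp := (Real.continuous_exp.tendsto _).comp hsum
  rw [Real.exp_add, Real.exp_log (div_pos (classL_pos hf t ⟨hs.trans hst.le, ht⟩)
    (classL_pos hf s ⟨hs, hst.le.trans ht⟩))] at hexp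
  refine hexp.congr' ?_
  filter_upwards [hclose] with m hm
  simp only [Function.comp_apply]
  rw [Real.exp_sum]
  refine Finset.prod_congr rfl fun i hi => Real.exp_log ?_
  have h1 := (abs_le.1 (hm i (Finset.mem_range.1 hi))).1
  have h2 := hcf _ (hmem m i) _ (hmem m (i + 1))
  linarith

/-- If the products of `1 + dg` along `λ` converge to the ratios of `f`, then `g - log f` is
nondecreasing. -/
theorem monotoneOn_sub_log_of_tendsto_prod (hf : f ∈ classL lam) (hg : HasLogJumps a b f g)
    (hprod : ∀ s t, a ≤ s → s < t → t ≤ b → Tendsto (fun m => ∏ i ∈ Finset.range (lam.n m),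
      (1 + g (lam.trace s t m (i + 1)) - g (lam.trace s t m i))) atTop (𝓝 (f t / f s))) :
    MonotoneOn (fun t => g t - Real.log (f t)) (Icc a b) := by
  intro s hs t ht hst
  rcases hst.eq_or_lt with rfl | hst'
  · exact le_rfl
  obtain ⟨c, hc, -, hcf, -⟩ := exists_le_div hf (hs.1.trans_lt (hst'.trans_le ht.2))
  have hmem : ∀ m i, lam.trace s t m i ∈ Icc a b := fun m i =>
    have h := lam.trace_mem_Icc hst'.le m i
    ⟨hs.1.trans h.1, h.2.trans ht.2⟩
  -- Multiply 1 + x ≤ eˣ over the partition, where the exponents telescope. Eventual positivity of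
  -- the factors is needed to multiply the inequalities.
  have hle : f t / f s ≤ Real.exp (g t - g s) := by
    refine le_of_tendsto (hprod s t hs.1 hst' ht.2) ?_
    filter_upwards [eventually_increment_close hf hg hc hs.1 hst' ht.2] with m hm
    rw [← lam.sumAlong_increment g hs.1 hst'.le ht.2 m, sumAlong, Real.exp_sum]
    refine Finset.prod_le_prod (fun i hi => ?_) (fun i _ => ?_)
    · have h1 := (abs_le.1 (hm i (Finset.mem_range.1 hi))).1
      have h2 := hcf _ (hmem m i) _ (hmem m (i + 1))
      linarith
    · have := Real.add_one_le_exp (g (lam.trace s t m (i + 1)) - g (lam.trace s t m i))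
      linarith
  have hs' := classL_pos hf s hs
  have ht' := classL_pos hf t ht
  have := (Real.log_le_iff_le_exp (div_pos ht' hs')).2 hle
  rw [Real.log_div ht'.ne' hs'.ne'] at this
  simp only
  linarith

end PartitionSeq

/-! ### The λ-logarithm, its product integral and uniqueness -/

namespace PartitionSeq

variable {a b : ℝ} {lam : PartitionSeq a b} {f g h : ℝ → ℝ}

/-- By Cauchy–Schwarz the cross term vanishes, so a perturbation with null quadratic variation
leaves the bracket unchanged. -/
theorem tendsto_sumAlong_add_sq {A D : ℝ → ℝ → ℝ} {s t w : ℝ}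
    (hA : Tendsto (lam.sumAlong (fun u v => A u v ^ 2) s t) atTop (𝓝 w))
    (hD : Tendsto (lam.sumAlong (fun u v => D u v ^ 2) s t) atTop (𝓝 0)) :
    Tendsto (lam.sumAlong (fun u v => (A u v + D u v) ^ 2) s t) atTop (𝓝 w) := by
  have hb : Tendsto (fun m => 2 * (√(lam.sumAlong (fun u v => A u v ^ 2) s t m) *
      √(lam.sumAlong (fun u v => D u v ^ 2) s t m))) atTop (𝓝 0) := by
    simpa using (hA.sqrt.mul hD.sqrt).const_mul 2
  have hc : Tendsto (lam.sumAlong (fun u v => 2 * (A u v * D u v)) s t) atTop (𝓝 0) := by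
    refine squeeze_zero_norm (fun m => ?_) hb
    have hcs := Real.sum_mul_le_sqrt_mul_sqrt (Finset.range (lam.n m))
      (fun i => |A (lam.trace s t m i) (lam.trace s t m (i + 1))|)
      (fun i => |D (lam.trace s t m i) (lam.trace s t m (i + 1))|)
    simp only [sq_abs] at hcs
    rw [sumAlong_mul, norm_mul, Real.norm_two]
    refine mul_le_mul_of_nonneg_left (le_trans ?_ hcs) zero_le_two
    refine (Finset.abs_sum_le_sum_abs _ _).trans_eq (Finset.sum_congr rfl fun i _ => abs_mul _ _)
  have := (hA.add hc).add hD
  rw [add_zero, add_zero] at this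
  refine this.congr fun m => ?_
  rw [← sumAlong_add, ← sumAlong_add]
  congr 1
  ext u v
  ring

theorem HasLogJumps.congr_add_const (hh : HasLogJumps a b f h) {c : ℝ}
    (hgh : ∀ t ∈ Icc a b, g t = h t + c) : HasLogJumps a b f g where
  left r hr := by
    have := (hh.left r hr).add_const c
    rw [hgh r ⟨hr.1.le, hr.2⟩, show h r + c - (f r - Function.leftLim f r) / Function.leftLim f r
      = h r - (f r - Function.leftLim f r) / Function.leftLim f r + c by ring]
    refine this.congr' ?_
    filter_upwards [Ioo_mem_nhdsLT hr.1] with x hx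
    exact (hgh x ⟨hx.1.le, hx.2.le.trans hr.2⟩).symm
  right r hr := by
    have := (hh.right r hr).add_const c
    rw [hgh r ⟨hr.1, hr.2.le⟩, show h r + c + (Function.rightLim f r - f r) / f r
      = h r + (Function.rightLim f r - f r) / f r + c by ring]
    refine this.congr' ?_
    filter_upwards [Ioo_mem_nhdsGT hr.2] with x hx
    exact (hgh x ⟨hr.1.trans hx.1.le, hx.2.le⟩).symm

theorem isLCPrimitive_of_hasLogJumps (hf : f ∈ classL lam) (hg : HasLogJumps a b f g)
    (hg0 : g a = 0) (hsum : ∀ s t, a ≤ s → s < t → t ≤ b →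
      Tendsto (lam.sumAlong (relIncr f) s t) atTop (𝓝 (g t - g s))) :
    IsLCPrimitive lam (fun u => (f u)⁻¹) f g := by
  refine ⟨hg.isRegulated, hg0, fun s t hs hst ht => ⟨?_, ?_, ?_⟩⟩
  · refine (hsum s t hs hst ht).congr fun m => Finset.sum_congr rfl fun i _ => ?_
    rw [relIncr, div_eq_inv_mul]
  · have ht' : t ∈ Ioc a b := ⟨hs.trans_lt hst, ht⟩
    obtain ⟨h1, h2⟩ := classL_left hf t ht'
    rw [hg.jumpLeft_eq ht', jumpLeft, if_pos ht'.1, leftLim_eq_of_tendsto (h1.inv₀ h2.ne'),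
      div_eq_inv_mul]
  · have hs' : s ∈ Ico a b := ⟨hs, hst.trans_le ht⟩
    rw [hg.jumpRight_eq hs', jumpRight, if_pos hs'.2, div_eq_inv_mul]

theorem logDefined_of_mem_classL (hf : f ∈ classL lam) : LogDefined lam f := by
  obtain ⟨Φ, h0, hΦ, hl, hr, -⟩ := exists_relIncr_primitive hf
  refine ⟨⟨fun t ht => ?_, fun s hs => ?_⟩, hf.1.1, Φ,
    isLCPrimitive_of_hasLogJumps hf ⟨hl, hr⟩ h0 hΦ⟩
  · obtain ⟨h1, h2⟩ := classL_left hf t ht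
    exact ⟨_, h1.inv₀ h2.ne'⟩
  · obtain ⟨h1, h2⟩ := classL_right hf s hs
    exact ⟨_, h1.inv₀ h2.ne'⟩

theorem lambdaLog_spec (hf : f ∈ classL lam) : lambdaLog lam f a = 0 ∧
    (∀ s t, a ≤ s → s < t → t ≤ b → Tendsto (lam.sumAlong (relIncr f) s t) atTop
      (𝓝 (lambdaLog lam f t - lambdaLog lam f s))) ∧
    HasLogJumps a b f (lambdaLog lam f) ∧
    MonotoneOn (fun t => lambdaLog lam f t - Real.log (f t)) (Icc a b) := by
  obtain ⟨Φ, h0, hΦ, hl, hr, hmono⟩ := exists_relIncr_primitive hf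
  have hdef : LCIntegrable lam (fun u => (f u)⁻¹) f := logDefined_of_mem_classL hf
  -- The primitive picked by choice agrees with Φ on [a, b] because both are limits of the same
  -- sums. The summand 0 matches the form of `congr_add_const`.
  have heq : ∀ t ∈ Icc a b, lambdaLog lam f t = Φ t + 0 := by
    intro t ht
    rw [lambdaLog, lcIntegral, dif_pos hdef, add_zero]
    rcases ht.1.eq_or_lt with rfl | hat
    · rw [sub_self, h0]
    · refine tendsto_nhds_unique (hdef.2.2.choose_spec.2.2 a t le_rfl hat ht.2).1 ?_
      have := hΦ a t le_rfl hat ht.2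
      rw [h0, sub_zero] at this
      refine this.congr fun m => Finset.sum_congr rfl fun i _ => ?_
      rw [relIncr, div_eq_inv_mul]
  refine ⟨?_, fun s t hs hst ht => ?_, HasLogJumps.congr_add_const ⟨hl, hr⟩ heq, ?_⟩
  · rw [lambdaLog, lcIntegral, dif_pos hdef, sub_self]
  · rw [heq t ⟨hs.trans hst.le, ht⟩, heq s ⟨hs, hst.le.trans ht⟩, add_zero, add_zero]
    exact hΦ s t hs hst ht
  · intro s hs t ht hst
    simpa only [heq s hs, heq t ht, add_zero] using hmono hs ht hst

/-- The bracket is W, since the increments differ from the relative increments of f by a defect with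
null quadratic variation. One plus a jump is a ratio of values or one-sided limits of f. -/
theorem lambdaLog_mem_classE (hab : a < b) (hf : f ∈ classL lam) : lambdaLog lam f ∈ classE lam := by
  obtain ⟨h0, -, hj, hmono⟩ := lambdaLog_spec hf
  obtain ⟨W, hW0, hW, hWl, hWr⟩ := exists_relIncr_bracket hf
  refine ⟨⟨hj.isRegulated, W, ⟨fun t ht => ⟨_, hWl t ht⟩, fun s hs => ⟨_, hWr s hs⟩⟩, hW0,
    fun s t hs hst ht => ⟨?_, ?_, ?_⟩⟩, h0, ?_, ?_⟩
  · refine (tendsto_sumAlong_add_sq (hW s t hs hst ht)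
      (tendsto_sumAlong_defect_sq hf hj hmono hs hst ht)).congr fun m => ?_
    exact Finset.sum_congr rfl fun i _ => by ring
  · have ht' : t ∈ Ioc a b := ⟨hs.trans_lt hst, ht⟩
    rw [hj.jumpLeft_eq ht', jumpLeft, if_pos ht'.1, leftLim_eq_of_tendsto (hWl t ht'),
      sub_sub_cancel]
  · have hs' : s ∈ Ico a b := ⟨hs, hst.trans_le ht⟩
    rw [hj.jumpRight_eq hs', jumpRight, if_pos hs'.2, rightLim_eq_of_tendsto (hWr s hs'),
      add_sub_cancel_left]
  · obtain ⟨c, hc, hc1, -, hcl, hcr⟩ := exists_le_div hf hab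
    refine ⟨c, hc, fun t ht => ?_⟩
    beta_reduce
    rw [← min_add_add_left, le_min_iff]
    constructor
    · rcases ht.1.eq_or_lt with rfl | hat
      · rwa [jumpLeft, if_neg (lt_irrefl _), add_zero]
      · have := hcl t ⟨hat, ht.2⟩
        rwa [hj.jumpLeft_eq ⟨hat, ht.2⟩, sub_div, div_self (classL_left hf t ⟨hat, ht.2⟩).2.ne',
          add_sub_cancel]
    · rcases ht.2.eq_or_lt with rfl | htb
      · rwa [jumpRight, if_neg (lt_irrefl _), add_zero]
      · have := hcr t ⟨ht.1, htb⟩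
        rwa [hj.jumpRight_eq ⟨ht.1, htb⟩, sub_div, div_self (classL_pos hf t ht).ne',
          add_sub_cancel]
  · rintro t ⟨ht, hne⟩
    refine hf.2.2.2 ⟨ht, fun h => hne ?_⟩
    rw [jumpRight, if_pos ht.2] at h
    rw [hj.jumpRight_eq ⟨ht.1.le, ht.2⟩, h, zero_div]

/-- The exponent in `tendsto_prod_one_add` vanishes, so f itself is the primitive. -/
theorem isProdPrimitive_of_eq_lambdaLog_add (hf : f ∈ classL lam) {c : ℝ}
    (hg : ∀ t ∈ Icc a b, g t = lambdaLog lam f t + c) : IsProdPrimitive lam g f := by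
  obtain ⟨-, hL, hj, hmono⟩ := lambdaLog_spec hf
  have hjg := hj.congr_add_const hg
  obtain ⟨C, hC, hCf⟩ := hf.2.2.1
  refine ⟨hf.1.1, hf.2.1, ⟨C, hC, fun t ht => (hCf t ht).trans (le_abs_self _)⟩,
    fun s t hs hst ht => ⟨?_, ?_, ?_⟩⟩
  · have hs' : s ∈ Icc a b := ⟨hs, hst.le.trans ht⟩
    have ht' : t ∈ Icc a b := ⟨hs.trans hst.le, ht⟩
    have hmono' : MonotoneOn (fun t => g t - Real.log (f t)) (Icc a b) := by
      intro x hx y hy hxy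
      have := hmono hx hy hxy
      simp only [hg x hx, hg y hy] at this ⊢
      linarith
    have := tendsto_prod_one_add hf hjg hmono' hs hst ht (hL s t hs hst ht)
    rwa [hg s hs', hg t ht', add_sub_add_right_eq_sub, sub_self, Real.exp_zero, mul_one] at this
  · have ht' : t ∈ Ioc a b := ⟨hs.trans_lt hst, ht⟩
    rw [hjg.jumpLeft_eq ht', sub_div, div_self (classL_left hf t ht').2.ne', add_sub_cancel]
  · have hs' : s ∈ Ico a b := ⟨hs, hst.trans_le ht⟩
    rw [hjg.jumpRight_eq hs', sub_div, div_self (classL_pos hf s ⟨hs, hs'.2.le⟩).ne',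
      add_sub_cancel]

/-- Any two primitives are limits of the same products over [a, x], so the choice in the definition
does not matter. -/
theorem prodIntegral_eq {H : ℝ → ℝ} (hreg : IsRegulated a b g) (hH : IsProdPrimitive lam g H)
    {s t : ℝ} (hs : a ≤ s) (hst : s ≤ t) (ht : t ≤ b) : prodIntegral lam g s t = H t / H s := by
  have hdef : ProdIntegrable lam g := ⟨hreg, H, hH⟩
  have hK := hdef.2.choose_spec
  rw [prodIntegral, dif_pos hdef]
  generalize hdef.2.choose = K at hK
  have heq : ∀ x ∈ Icc a b, K x = H x := by
    intro x hx
    rcases hx.1.eq_or_lt with rfl | hax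
    · rw [hK.2.1, hH.2.1]
    · have := tendsto_nhds_unique (hK.2.2.2 a x le_rfl hax hx.2).1 (hH.2.2.2 a x le_rfl hax hx.2).1
      rwa [hK.2.1, hH.2.1, div_one, div_one] at this
  rw [heq t ⟨hs.trans hst, ht⟩, heq s ⟨hs, hst.trans ht⟩]

theorem hasLogJumps_of_isProdPrimitive (hf : f ∈ classL lam) {H : ℝ → ℝ}
    (hreg : IsRegulated a b g) (hH : IsProdPrimitive lam g H) (heq : ∀ t ∈ Icc a b, H t = f t) :
    HasLogJumps a b f g where
  left r hr := by
    have hlim := hreg.tendsto_leftLim hr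
    obtain ⟨h1, h2⟩ := classL_left hf r hr
    have hHf : Function.leftLim H r = Function.leftLim f r := by
      refine leftLim_eq_of_tendsto (h1.congr' ?_)
      filter_upwards [Ioo_mem_nhdsLT hr.1] with x hx
      exact (heq x ⟨hx.1.le, hx.2.le.trans hr.2⟩).symm
    have hjump := (hH.2.2.2 a r le_rfl hr.1 hr.2).2.1
    rw [hHf, heq r ⟨hr.1.le, hr.2⟩, jumpLeft, if_pos hr.1] at hjump
    rw [sub_div, div_self h2.ne', hjump]
    convert hlim using 2
    ring
  right r hr := by
    have hlim := hreg.tendsto_rightLim hr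
    have hr' : r ∈ Icc a b := ⟨hr.1, hr.2.le⟩
    have hHf : Function.rightLim H r = Function.rightLim f r := by
      refine rightLim_eq_of_tendsto ((classL_right hf r hr).1.congr' ?_)
      filter_upwards [Ioo_mem_nhdsGT hr.2] with x hx
      exact (heq x ⟨hr.1.trans hx.1.le, hx.2.le⟩).symm
    have hjump := (hH.2.2.2 r b hr.1 hr.2 le_rfl).2.2
    rw [hHf, heq r hr', jumpRight, if_pos hr.2] at hjump
    rw [sub_div, div_self (classL_pos hf r hr').ne', hjump]
    convert hlim using 2
    ring

/-- The products have limit f t/f a by assumption and this times exp(g t - g a - `lambdaLog` t) by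
`tendsto_prod_one_add`, so the exponent is 0. -/
theorem eq_lambdaLog_add_of_isProdPrimitive (hf : f ∈ classL lam) {H : ℝ → ℝ}
    (hreg : IsRegulated a b g) (hH : IsProdPrimitive lam g H) (heq : ∀ t ∈ Icc a b, H t = f t) :
    ∀ t ∈ Icc a b, g t = lambdaLog lam f t + g a := by
  intro t ht
  obtain ⟨h0, hL, -, -⟩ := lambdaLog_spec hf
  rcases ht.1.eq_or_lt with rfl | hat
  · rw [h0, zero_add]
  have hj := hasLogJumps_of_isProdPrimitive hf hreg hH heq
  have hprod : ∀ s t, a ≤ s → s < t → t ≤ b → Tendsto (fun m => ∏ i ∈ Finset.range (lam.n m),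
      (1 + g (lam.trace s t m (i + 1)) - g (lam.trace s t m i))) atTop (𝓝 (f t / f s)) := by
    intro s t hs hst ht
    have := (hH.2.2.2 s t hs hst ht).1
    rwa [heq t ⟨hs.trans hst.le, ht⟩, heq s ⟨hs, hst.le.trans ht⟩] at this
  have hlim := tendsto_prod_one_add hf hj (monotoneOn_sub_log_of_tendsto_prod hf hj hprod) le_rfl
    hat ht.2 (hL a t le_rfl hat ht.2)
  have huniq := tendsto_nhds_unique hlim (hprod a t le_rfl hat ht.2)
  have hne : f t / f a ≠ 0 :=
    (div_pos (classL_pos hf t ht) (classL_pos hf a ⟨le_rfl, ht.1.trans ht.2⟩)).ne'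
  have := Real.exp_eq_one_iff _ |>.1 ((mul_eq_left₀ hne).1 huniq)
  rw [h0] at this
  linarith

theorem isGenerator_lambdaLog {U : ℝ → ℝ → ℝ} (hU : IsEvolution a b U)
    (hf : (fun t => U t a) ∈ classL lam) : IsGenerator lam U (lambdaLog lam (fun t => U t a)) := by
  obtain ⟨h0, hL, hj, -⟩ := lambdaLog_spec hf
  refine ⟨hj.isRegulated, h0, fun s t hs hst ht => ⟨?_, ?_, ?_⟩⟩
  · refine (hL s t hs hst ht).congr fun m => Finset.sum_congr rfl fun i hi => ?_
    have hx := lam.trace_mem_Icc hst.le m i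
    have hy := lam.trace_mem_Icc hst.le m (i + 1)
    have hax := hs.trans hx.1
    have hmul := hU.1 a _ _ le_rfl hax
      (lam.trace_mono (s := s) (t := t) (Nat.le_succ i) (Finset.mem_range.1 hi)) (hy.2.trans ht)
    have hne : U (lam.trace s t m i) a ≠ 0 := (classL_pos hf _ ⟨hax, hx.2.trans ht⟩).ne'
    rw [relIncr, sub_div, div_self hne, ← hmul, mul_div_cancel_right₀ _ hne]
  · have ht' : t ∈ Ioc a b := ⟨hs.trans_lt hst, ht⟩
    rw [hj.jumpLeft_eq ht', sub_div, div_self (classL_left hf t ht').2.ne']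
  · have hs' : s ∈ Ico a b := ⟨hs, hst.trans_le ht⟩
    rw [hj.jumpRight_eq hs', sub_div, div_self (classL_pos hf s ⟨hs, hs'.2.le⟩).ne']

end PartitionSeq

/-! ### The theorem -/

open PartitionSeq in
theorem mainTheorem1 {a b : ℝ} (hab : a < b) (lam : PartitionSeq a b) (U : ℝ → ℝ → ℝ)
    (hU : IsRegulatedEvolution a b U) (hL : (fun t => U t a) ∈ classL lam) :
    (LogDefined lam (fun t => U t a) ∧
      lambdaLog lam (fun t => U t a) ∈ classE lam ∧
      IsGenerator lam U (lambdaLog lam (fun t => U t a))) ∧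
    ProdIntegrable lam (lambdaLog lam (fun t => U t a)) ∧
    (∀ s t, a ≤ s → s ≤ t → t ≤ b →
      U t s = prodIntegral lam (lambdaLog lam (fun t => U t a)) s t) ∧
    (∀ g : ℝ → ℝ, (fun t => g t - g a) ∈ classE lam →
      ((ProdIntegrable lam g ∧
          ∀ s t, a ≤ s → s ≤ t → t ≤ b → U t s = prodIntegral lam g s t) ↔
        ∃ c : ℝ, ∀ t ∈ Set.Icc a b, g t = lambdaLog lam (fun t => U t a) t + c)) := by
  have hdiv : ∀ s t, a ≤ s → s ≤ t → t ≤ b → U t s = U t a / U s a := by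
    intro s t hs hst ht
    rw [eq_div_iff (classL_pos hL s ⟨hs, hst.trans ht⟩).ne']
    exact hU.1.1 a s t le_rfl hs hst ht
  have hlog : ∀ g : ℝ → ℝ, ∀ c : ℝ,
      (∀ t ∈ Set.Icc a b, g t = lambdaLog lam (fun t => U t a) t + c) →
      ProdIntegrable lam g ∧ ∀ s t, a ≤ s → s ≤ t → t ≤ b → U t s = prodIntegral lam g s t := by
    intro g c hg
    have hreg := ((lambdaLog_spec hL).2.2.1.congr_add_const hg).isRegulated
    have hprim := isProdPrimitive_of_eq_lambdaLog_add hL hg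
    exact ⟨⟨hreg, _, hprim⟩, fun s t hs hst ht => by
      rw [prodIntegral_eq hreg hprim hs hst ht, hdiv s t hs hst ht]⟩
  have hself := hlog _ 0 fun t _ => (add_zero _).symm
  refine ⟨⟨logDefined_of_mem_classL hL, lambdaLog_mem_classE hab hL,
    isGenerator_lambdaLog hU.1 hL⟩, hself.1, hself.2, fun g _ => ⟨?_, fun ⟨c, hc⟩ => hlog g c hc⟩⟩
  rintro ⟨⟨hreg, H, hH⟩, hUH⟩
  -- The constant must be g a because the λ-logarithm vanishes at a; that H agrees with U_a is the
  -- case s = a of the product formula.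
  refine ⟨g a, eq_lambdaLog_add_of_isProdPrimitive hL hreg hH fun t ht => ?_⟩
  have := hUH a t le_rfl ht.1 ht.2
  rw [prodIntegral_eq hreg hH le_rfl ht.1 ht.2, hH.2.1, div_one] at this
  exact this.symm
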